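/- A pipe dream of rank $m\ge 0$ fills the staircase whose row $i$ ($1\le i\le m$, counted from the top) has the $m+1-i$ left-justified tiles $(i,1),\dots,(i,m+1-i)$ with crossing tiles and bumping tiles, each tile $(i,m+1-i)$ being a bumping tile. From the top of each column $c=1,\dots,m$ a pipe enters; it moves down and to the left and leaves through the left boundary. In a crossing tile pipes go straight on; in a bumping tile the pipe coming from the top leaves to the left and the pipe coming from the right leaves through the bottom. The pipe dream is reduced if any two pipes cross at most once. Let $v$ be a word of length $m$ with distinct positive integer entries. Label the pipes from left to right along the top by the entries of $v$ in increasing order. A reduced pipe dream of $v$ is a reduced pipe dream of rank $m$ for which the labels along the left boundary, read from top to bottom, form $v$. A marked reduced pipe dream of $v$ is such a pipe dream together with a (possibly empty) set of marked bumping tiles, where a bumping tile in row $i$ may be marked only if it is traversed by two pipes that cross somewhere above row $i$. Let $\mathrm{MRPD}(v)$ be the set of these. Pipe $j$ of $P\in\mathrm{MRPD}(v)$ is removable if (i) in the column $C_j$ where it enters, all crossing tiles are traversed by pipe $j$ and no tile is marked; (ii) no tile directly above a crossing tile traversed by pipe $j$ is an unmarked bumping tile; (iii) pipe $j$ traverses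 no marked tile. Let $\mathrm{CMRPD}(v)$ be the set of those $P\in\mathrm{MRPD}(v)$ that are core, i.e. have no removable pipe. If pipe $j$ of $P$ is removable, define $\Phi_j(P)$ by deletion and merging: delete column $C_j$ and move all tiles to the right of it one column to the left. In each column $k$ to the left of $C_j$, pipe $j$ enters from the right, in some tile $(r,k)$, and traverses either only this tile, a crossing tile, or exactly two tiles, the unmarked bumping tiles $(r,k)$ and $(r+1,k)$. In the first case delete the tile $(r,k)$; in the second case delete the lower right half of $(r,k)$ and the upper left half of $(r+1,k)$, so that the remaining two halves merge to an unmarked bumping tile $(r,k)$. In both cases move everything in column $k$ below the deleted part up by one row. The result is a filling of rank $m-1$ for the word obtained from $v$ by deleting the entry $j$. For a permutation $w\in S_n$, written as the word $w(1)\cdots w(n)$, and $P\in\mathrm{MRPD}(w)$ with removable pipes $j_1,\dots,j_k$, let $$\Phi(P)=\Phi_{j_k}(\cdots\Phi_{j_2}(\Phi_{j_1}(P))\cdots),$$ regarded as a pipe dream of the word obtained from $w$ by deleting the entries $j_1,\dots,j_k$. Here the removable pipes are deleted in the order in which their labels occur in some arbitrary fixed ordering of $\{1,\dots,n\}$. **Theorem.**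 Let $w\in S_n$ be a permutation that avoids the pattern $1423$, i.e. there are no $a<b<c<d$ with $w(a)<w(c)<w(d)<w(b)$. Then, whatever ordering of $\{1,\dots,n\}$ is used, the map $$\Phi\colon \mathrm{MRPD}(w)\longrightarrow \bigsqcup_{v\le w}\mathrm{CMRPD}(v)$$ is (well defined and) a bijection, where $v$ runs over all subwords of $w$, including the empty one and $w$ itself. -/

import Mathlib

namespace PipeDream

/-- The three kinds of tiles: an (unmarked) bumping tile, a marked bumping tile, a crossing tile. -/
inductive Tile
  | bump
  | marked
  | cross

/-- A filling `P`, with `P i j` the tile in row `i` and column `j`; rows are counted from the top,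
columns from the left, and both counts start at `0`. A filling of the staircase of rank `m` is
extended by unmarked bumping tiles to all positions that lie outside of it. -/
abbrev Filling := ℕ → ℕ → Tile

/-- The side through which a pipe enters a tile. -/
inductive Side
  | top
  | right

/-- `Enters P c s i j`: in `P`, the pipe that enters from the top boundary in column `c` passes
through the tile `(i, j)`, which it enters from the side `s`. In a crossing tile pipes go straight
on; in a bumping tile (marked or not) the pipe that comes from the top leaves to the left, and the
pipe that comes from the right leaves through the bottom. -/
inductive Enters (P : Filling) (c : ℕ) : Side → ℕ → ℕ → Prop
  | start : Enters P c Side.top 0 c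
  | cross_down {i j : ℕ} : Enters P c Side.top i j → P i j = Tile.cross →
      Enters P c Side.top (i + 1) j
  | bump_left {i j : ℕ} : Enters P c Side.top i (j + 1) → P i (j + 1) ≠ Tile.cross →
      Enters P c Side.right i j
  | cross_left {i j : ℕ} : Enters P c Side.right i (j + 1) → P i (j + 1) = Tile.cross →
      Enters P c Side.right i j
  | bump_down {i j : ℕ} : Enters P c Side.right i j → P i j ≠ Tile.cross →
      Enters P c Side.top (i + 1) j

/-- The pipe that enters in column `c` passes through the tile `(i, j)`. -/
def Traverses (P : Filling) (c i j : ℕ) : Prop :=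
  Enters P c Side.top i j ∨ Enters P c Side.right i j

/-- The pipe that enters in column `c` leaves through the left boundary in row `i`. -/
def Exits (P : Filling) (c i : ℕ) : Prop :=
  (Enters P c Side.top i 0 ∧ P i 0 ≠ Tile.cross) ∨
    (Enters P c Side.right i 0 ∧ P i 0 = Tile.cross)

/-- The pipes that enter in columns `c` and `d` are the two pipes that meet in the tile `(i, j)`. -/
def Meet (P : Filling) (c d i j : ℕ) : Prop :=
  (Enters P c Side.top i j ∧ Enters P d Side.right i j) ∨
    (Enters P d Side.top i j ∧ Enters P c Side.right i j)

/-- The pipes that enter in columns `c` and `d` cross in the tile `(i, j)`. -/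
def CrossAt (P : Filling) (c d i j : ℕ) : Prop :=
  P i j = Tile.cross ∧ Meet P c d i j

/-- The pipes of a pipe dream of a word `v` are labelled from left to right by the entries of `v`
in increasing order. This is the column in which the pipe labelled `a` enters. -/
def entryCol (v : List ℕ) (a : ℕ) : ℕ := v.countP (fun b => decide (b < a))

/-- The marked reduced pipe dreams of a word `v` with distinct entries. The rank is the length `m`
of `v`: in the row with index `i` the staircase has the columns `0, …, m - 1 - i`. -/
structure IsMRPD (v : List ℕ) (P : Filling) : Prop where
  /-- The tiles on the southeast diagonal are unmarked bumping tiles, and so is the padding. -/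
  staircase : ∀ i j, v.length ≤ i + j + 1 → P i j = Tile.bump
  /-- The labels along the left boundary, from top to bottom, form the word `v`. -/
  word : ∀ (i : ℕ) (hi : i < v.length), Exits P (entryCol v v[i]) i
  /-- Any two pipes cross at most once. -/
  reduced : ∀ c < v.length, ∀ d < v.length, c ≠ d → ∀ i j i' j',
    CrossAt P c d i j → CrossAt P c d i' j' → i = i' ∧ j = j'
  /-- A bumping tile is marked only if the two pipes in it cross at some position above its row. -/
  marked : ∀ i j, P i j = Tile.marked → ∃ c < v.length, ∃ d < v.length, c ≠ d ∧
    Meet P c d i j ∧ ∃ i' < i, ∃ j', CrossAt P c d i' j'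

/-- The set of marked reduced pipe dreams of the word `v`. -/
def MRPD (v : List ℕ) : Set Filling := {P | IsMRPD v P}

/-- The pipe that enters in column `c` is removable. -/
structure RemovableCol (P : Filling) (c : ℕ) : Prop where
  /-- In the column where the pipe enters, it traverses all crossing tiles. -/
  entry_cross : ∀ i, P i c = Tile.cross → Traverses P c i c
  /-- In the column where the pipe enters, no tile is marked. -/
  entry_unmarked : ∀ i, P i c ≠ Tile.marked
  /-- No tile directly above a crossing tile of the pipe is an unmarked bumping tile. -/
  above_cross : ∀ i j, P (i + 1) j = Tile.cross → Traverses P c (i + 1) j → P i j ≠ Tile.bump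
  /-- The pipe traverses no marked tile. -/
  unmarked : ∀ i j, Traverses P c i j → P i j ≠ Tile.marked

/-- The pipe labelled `a` in the pipe dream `P` of the word `v` is removable. -/
def Removable (v : List ℕ) (P : Filling) (a : ℕ) : Prop :=
  a ∈ v ∧ RemovableCol P (entryCol v a)

/-- The set of core marked reduced pipe dreams of `v`: no pipe is removable. -/
def CMRPD (v : List ℕ) : Set Filling := {P | P ∈ MRPD v ∧ ∀ a, ¬ Removable v P a}

open Classical in
/-- Deletion of the (removable) pipe that enters in column `c`, followed by merging.
Column `c` is deleted and everything to the right of it moves one column to the left.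
In a column `j` to the left of column `c`, let `i₀` be the row in which the pipe enters the column
from the right. If `(i₀, j)` is a crossing tile, this tile is deleted and everything below it moves
up. If it is a bumping tile, the pipe occupies the lower right half of `(i₀, j)` and the upper left
half of the bumping tile `(i₀ + 1, j)`; these two halves are deleted, everything below moves up,
and the two halves that remain form an unmarked bumping tile in position `(i₀, j)`. -/
noncomputable def deleteCol (P : Filling) (c : ℕ) : Filling := fun i j =>
  if c ≤ j then P i (j + 1)
  else if Enters P c Side.right i j ∧ P i j ≠ Tile.cross then Tile.bump
  else if ∃ i₀ ≤ i, Enters P c Side.right i₀ j then P (i + 1) j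
  else P i j

/-- The map `Φ_a`: from a pipe dream of a word `v` (given as a pair `(v, P)`), delete the pipe with
label `a`. The result is a pair whose word is `v` without the entry `a`. -/
noncomputable def deletePipe (D : List ℕ × Filling) (a : ℕ) : List ℕ × Filling :=
  (D.1.erase a, deleteCol D.2 (entryCol D.1 a))

open Classical in
/-- The reduction map `Φ` on the pipe dreams `P` of the word `v`: all removable pipes `a₁, …, aₖ`
of `P` are deleted, one after the other. The list `order` contains the labels of all pipes and
prescribes in which order the removable ones among them are deleted. -/
noncomputable def reduction (order v : List ℕ) (P : Filling) : List ℕ × Filling :=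
  (order.filter (fun a => decide (Removable v P a))).foldl deletePipe (v, P)

/-- The one-line notation `w(1) w(2) ⋯ w(n)` of a permutation, with values in `{1, …, n}`. -/
def oneLine {n : ℕ} (w : Equiv.Perm (Fin n)) : List ℕ := List.ofFn (fun i => (w i : ℕ) + 1)

/-- The permutation avoids the pattern `1423`. -/
def Avoids1423 {n : ℕ} (w : Equiv.Perm (Fin n)) : Prop :=
  ¬ ∃ i j k l : Fin n, i < j ∧ j < k ∧ k < l ∧ w i < w k ∧ w k < w l ∧ w l < w j

/-- The disjoint union of the sets of core marked reduced pipe dreams of all subwords `v` of `w`,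
the empty subword included; a point of it is a pair `(v, Q)`. -/
def coresOfSubwords {n : ℕ} (w : Equiv.Perm (Fin n)) : Set (List ℕ × Filling) :=
  {D | D.1.Sublist (oneLine w) ∧ D.2 ∈ CMRPD D.1}

end PipeDream

/-! With the padding by bumping tiles, every edge of the quadrant lies on exactly one pipe. Each
step of a pipe raises row minus column by one, so a pipe meets a diagonal at most once, and the
pipes on a diagonal are ordered by `Side.rank`. A bump keeps the order of its two pipes, a crossing
swaps it. Hence reducedness and the rule for marks amount to a tilewise comparison of starting
columns, `LocallyValid`.

Deletion is studied through its graph `IsInsertion Q P c e`. Removability of pipe `c` says that in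
each column to its left the pipe uses one crossing tile or two unmarked bumping tiles, and that no
crossing of it lies directly below an unmarked bump. Read from the left boundary to the right, the
route is therefore forced by `Q`: an unmarked bump directly above must be split, any other tile is
passed below by a crossing. So `Q`, `c` and the exit row determine `P` (`IsInsertion.unique`), and
this route always exists (`exists_isInsertion`). The other pipes are only relabelled monotonically,
and their removability does not change in either direction (`IsInsertion.removableCol_skip_iff`). So
the initial list of removable labels stays valid during the deletions, and the result is core.

Pattern avoidance is needed only for `P` to be reduced: a wrong crossing of the inserted pipe with a
pipe starting further right forces pipes that leave in the pattern `1423`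
(`IsInsertion.exists_exits_of_crossing`). Finally, the word of the image shows which labels were
removed, and induction over these labels gives the bijection. -/

namespace PipeDream

/-! ### Pipes: uniqueness, existence and bounds -/

variable {P Q : Filling} {c d m i j : ℕ}

/-- The pipe that enters in column `c` leaves the tile `(i, j)` to the left. -/
def LeavesLeft (P : Filling) (c i j : ℕ) : Prop :=
  (Enters P c Side.top i j ∧ P i j ≠ Tile.cross) ∨ (Enters P c Side.right i j ∧ P i j = Tile.cross)

/-- All tiles outside of the staircase of rank `m`, and those on its diagonal, are unmarked
bumping tiles. -/
def Padded (m : ℕ) (P : Filling) : Prop := ∀ i j, m ≤ i + j + 1 → P i j = Tile.bump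

theorem enters_right_iff : Enters P c Side.right i j ↔ LeavesLeft P c i (j + 1) := by
  constructor
  · intro h
    cases h with
    | bump_left h1 h2 => exact Or.inl ⟨h1, h2⟩
    | cross_left h1 h2 => exact Or.inr ⟨h1, h2⟩
  · rintro (⟨h1, h2⟩ | ⟨h1, h2⟩)
    · exact .bump_left h1 h2
    · exact .cross_left h1 h2

/-- Pipes can be traced backwards: an edge and the tile behind it determine the previous edge. -/
theorem Enters.label_unique {s : Side} (h : Enters P c s i j) : Enters P d s i j → c = d := by
  induction h with
  | start => intro h; cases h; rfl
  | cross_down h1 h2 ih =>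
    intro h
    cases h with
    | cross_down h3 h4 => exact ih h3
    | bump_down h3 h4 => exact absurd h2 h4
  | bump_left h1 h2 ih =>
    intro h
    cases h with
    | bump_left h3 h4 => exact ih h3
    | cross_left h3 h4 => exact absurd h4 h2
  | cross_left h1 h2 ih =>
    intro h
    cases h with
    | bump_left h3 h4 => exact absurd h2 h4
    | cross_left h3 h4 => exact ih h3
  | bump_down h1 h2 ih =>
    intro h
    cases h with
    | cross_down h3 h4 => exact absurd h4 h2
    | bump_down h3 h4 => exact ih h3

theorem LeavesLeft.label_unique (h : LeavesLeft P c i j) (h' : LeavesLeft P d i j) : c = d := by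
  rcases h with ⟨h1, h2⟩ | ⟨h1, h2⟩ <;> rcases h' with ⟨h3, h4⟩ | ⟨h3, h4⟩
  · exact h1.label_unique h3
  · exact absurd h4 h2
  · exact absurd h2 h4
  · exact h1.label_unique h3

/-- Induction on the row. Within a row, a right edge is traced rightwards through crossings, which
end at the padding. -/
theorem Padded.exists_enters (hP : Padded m P) (s : Side) (i j : ℕ) : ∃ c, Enters P c s i j := by
  have right_of_top : ∀ i, (∀ j, ∃ c, Enters P c Side.top i j) →
      ∀ k j, m ≤ j + k → ∃ c, Enters P c Side.right i j := by
    intro i hi k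
    induction k with
    | zero =>
      intro j hj
      obtain ⟨c, hc⟩ := hi (j + 1)
      exact ⟨c, .bump_left hc (by rw [hP _ _ (by omega)]; simp)⟩
    | succ k ih =>
      intro j hj
      by_cases hx : P i (j + 1) = Tile.cross
      · obtain ⟨c, hc⟩ := ih (j + 1) (by omega)
        exact ⟨c, .cross_left hc hx⟩
      · obtain ⟨c, hc⟩ := hi (j + 1)
        exact ⟨c, .bump_left hc hx⟩
  have top : ∀ i j, ∃ c, Enters P c Side.top i j := by
    intro i
    induction i with
    | zero => exact fun j => ⟨j, .start⟩
    | succ i ih =>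
      intro j
      by_cases hx : P i j = Tile.cross
      · obtain ⟨c, hc⟩ := ih j
        exact ⟨c, .cross_down hc hx⟩
      · obtain ⟨c, hc⟩ := right_of_top i ih m j (by omega)
        exact ⟨c, .bump_down hc hx⟩
  cases s with
  | top => exact top i j
  | right => exact right_of_top i (top i) m j (by omega)

theorem Padded.exists_leavesLeft (hP : Padded m P) (i j : ℕ) : ∃ c, LeavesLeft P c i j := by
  obtain ⟨c, hc⟩ := hP.exists_enters Side.right i j
  obtain ⟨d, hd⟩ := hP.exists_enters Side.top i j
  by_cases hx : P i j = Tile.cross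
  · exact ⟨c, Or.inr ⟨hc, hx⟩⟩
  · exact ⟨d, Or.inl ⟨hd, hx⟩⟩

theorem Enters.col_le {s : Side} (h : Enters P c s i j) :
    j ≤ c ∧ (s = Side.right → j < c) := by
  induction h with
  | start => simp
  | cross_down h1 h2 ih => exact ⟨ih.1, by simp⟩
  | bump_left h1 h2 ih => exact ⟨by omega, fun _ => by omega⟩
  | cross_left h1 h2 ih => exact ⟨by omega, fun _ => by omega⟩
  | bump_down h1 h2 ih => exact ⟨ih.1, by simp⟩

/-- A pipe that enters inside the staircase stays inside. -/
theorem Enters.add_lt (hP : Padded m P) {s : Side} (h : Enters P c s i j) (hc : c < m) :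
    i + j < m ∧ (s = Side.right → i + j + 1 < m) := by
  induction h with
  | start => simp [hc]
  | @cross_down i j h1 h2 ih =>
    refine ⟨?_, by simp⟩
    by_contra hcon
    rw [hP i j (by omega)] at h2
    cases h2
  | bump_left h1 h2 ih => exact ⟨by omega, fun _ => by omega⟩
  | cross_left h1 h2 ih => exact ⟨by omega, fun _ => by have := ih.2 rfl; omega⟩
  | bump_down h1 h2 ih => exact ⟨by have := ih.2 rfl; omega, by simp⟩

/-- A pipe that enters outside of the staircase stays outside. -/
theorem Enters.le_add (hP : Padded m P) {s : Side} (h : Enters P c s i j) (hc : m ≤ c) :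
    m ≤ i + j + 1 ∧ (s = Side.top → m ≤ i + j) := by
  induction h with
  | start => simp [hc]; omega
  | cross_down h1 h2 ih => exact ⟨by omega, fun _ => by have := ih.2 rfl; omega⟩
  | bump_left h1 h2 ih => exact ⟨by have := ih.2 rfl; omega, by simp⟩
  | @cross_left i j h1 h2 ih =>
    rw [hP i (j + 1) (by omega)] at h2
    cases h2
  | bump_down h1 h2 ih => exact ⟨by omega, fun _ => by omega⟩

theorem Enters.lt_of_ne_bump (hP : Padded m P) {s : Side} (h : Enters P c s i j)
    (hx : P i j ≠ Tile.bump) : c < m := by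
  by_contra hc
  exact hx (hP i j (h.le_add hP (by omega)).1)

theorem Padded.exists_leavesLeft_of_enters (hP : Padded m P) (h : Enters P c Side.top i j) :
    ∃ k, i ≤ k ∧ LeavesLeft P c k j ∧ ∀ r, i ≤ r → r ≤ k → Enters P c Side.top r j := by
  have key : ∀ n i, m ≤ i + n → Enters P c Side.top i j →
      ∃ k, i ≤ k ∧ LeavesLeft P c k j ∧ ∀ r, i ≤ r → r ≤ k → Enters P c Side.top r j := by
    intro n
    induction n with
    | zero =>
      intro i hi h
      refine ⟨i, le_rfl, Or.inl ⟨h, by rw [hP i j (by omega)]; simp⟩, fun r h1 h2 => ?_⟩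
      rwa [le_antisymm h2 h1]
    | succ n ih =>
      intro i hi h
      by_cases hx : P i j = Tile.cross
      · obtain ⟨k, hk, h', hr⟩ := ih (i + 1) (by omega) (.cross_down h hx)
        refine ⟨k, by omega, h', fun r h1 h2 => ?_⟩
        rcases h1.eq_or_lt with rfl | h1
        · exact h
        · exact hr r h1 h2
      · refine ⟨i, le_rfl, Or.inl ⟨h, hx⟩, fun r h1 h2 => ?_⟩
        rwa [le_antisymm h2 h1]
  exact key m i (by omega) h

/-- Going down the column in which it enters, a pipe either is still in that column or has left
it to the left. -/
theorem enters_or_leavesLeft (P : Filling) (i j : ℕ) :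
    Enters P j Side.top i j ∨ ∃ k < i, LeavesLeft P j k j := by
  induction i with
  | zero => exact Or.inl .start
  | succ i ih =>
    rcases ih with h | ⟨k, hk, h⟩
    · by_cases hx : P i j = Tile.cross
      · exact Or.inl (.cross_down h hx)
      · exact Or.inr ⟨i, by omega, Or.inl ⟨h, hx⟩⟩
    · exact Or.inr ⟨k, by omega, h⟩

/-! ### The order of the pipes on diagonals -/

/-- The number of the position, on the diagonal through the tile `(i, j)`, in which a pipe enters
this tile. -/
def Side.rank (i : ℕ) : Side → ℕ
  | Side.top => 2 * i
  | Side.right => 2 * i + 1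

theorem Enters.le_add_label {s : Side} (h : Enters P c s i j) :
    j ≤ i + c ∧ (j = i + c → s = Side.top ∧ i = 0) := by
  induction h with
  | start => simp
  | cross_down h1 h2 ih => exact ⟨by omega, fun _ => by omega⟩
  | bump_left h1 h2 ih => exact ⟨by omega, fun _ => by omega⟩
  | cross_left h1 h2 ih => exact ⟨by omega, fun _ => by omega⟩
  | bump_down h1 h2 ih => exact ⟨by omega, fun _ => by omega⟩

/-- A pipe meets every diagonal at most once. -/
theorem Enters.eq_of_diagonal {s : Side} (h : Enters P c s i j) :
    ∀ {s' : Side} {i' j' : ℕ}, Enters P c s' i' j' → i + j' = i' + j →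
      s = s' ∧ i = i' ∧ j = j' := by
  induction h with
  | start =>
    intro s' i' j' h' e
    obtain ⟨h1, h2⟩ := h'.le_add_label
    obtain ⟨rfl, rfl⟩ := h2 (by omega)
    exact ⟨rfl, rfl, by omega⟩
  | @cross_down i j h1 h2 ih =>
    intro s' i' j' h' e
    cases h' with
    | start => have := h1.le_add_label; omega
    | cross_down h3 h4 => have := ih h3 (by omega); simp; omega
    | bump_left h3 h4 =>
      obtain ⟨_, rfl, rfl⟩ := ih h3 (by omega); exact absurd h2 h4
    | cross_left h3 h4 => obtain ⟨h, _, _⟩ := ih h3 (by omega); cases h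
    | bump_down h3 h4 => obtain ⟨h, _, _⟩ := ih h3 (by omega); cases h
  | @bump_left i j h1 h2 ih =>
    intro s' i' j' h' e
    cases h' with
    | start => have := h1.le_add_label; omega
    | cross_down h3 h4 =>
      obtain ⟨_, rfl, rfl⟩ := ih h3 (by omega); exact absurd h4 h2
    | bump_left h3 h4 => have := ih h3 (by omega); simp; omega
    | cross_left h3 h4 => obtain ⟨h, _, _⟩ := ih h3 (by omega); cases h
    | bump_down h3 h4 => obtain ⟨h, _, _⟩ := ih h3 (by omega); cases h
  | @cross_left i j h1 h2 ih =>
    intro s' i' j' h' e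
    cases h' with
    | start => have := h1.le_add_label; omega
    | cross_down h3 h4 => obtain ⟨h, _, _⟩ := ih h3 (by omega); cases h
    | bump_left h3 h4 => obtain ⟨h, _, _⟩ := ih h3 (by omega); cases h
    | cross_left h3 h4 => have := ih h3 (by omega); simp; omega
    | bump_down h3 h4 =>
      obtain ⟨_, rfl, rfl⟩ := ih h3 (by omega); exact absurd h2 h4
  | @bump_down i j h1 h2 ih =>
    intro s' i' j' h' e
    cases h' with
    | start => have := h1.le_add_label; omega
    | cross_down h3 h4 => obtain ⟨h, _, _⟩ := ih h3 (by omega); cases h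
    | bump_left h3 h4 => obtain ⟨h, _, _⟩ := ih h3 (by omega); cases h
    | cross_left h3 h4 =>
      obtain ⟨_, rfl, rfl⟩ := ih h3 (by omega); exact absurd h4 h2
    | bump_down h3 h4 => have := ih h3 (by omega); simp; omega

theorem Enters.row_mono {s : Side} (h : Enters P c s i j) :
    ∀ {s' : Side} {i' j' : ℕ}, Enters P c s' i' j' → i' + j ≤ i + j' → i' ≤ i := by
  induction h with
  | start =>
    intro s' i' j' h' e
    have := h'.le_add_label
    omega
  | @cross_down i j h1 h2 ih =>
    intro s' i' j' h' e
    by_cases he : i' + j = i + 1 + j'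
    · exact ((Enters.cross_down h1 h2).eq_of_diagonal h' he.symm).2.1.ge
    · exact (ih h' (by omega)).trans (by omega)
  | @bump_left i j h1 h2 ih =>
    intro s' i' j' h' e
    by_cases he : i' + j = i + j'
    · exact ((Enters.bump_left h1 h2).eq_of_diagonal h' he.symm).2.1.ge
    · exact ih h' (by omega)
  | @cross_left i j h1 h2 ih =>
    intro s' i' j' h' e
    by_cases he : i' + j = i + j'
    · exact ((Enters.cross_left h1 h2).eq_of_diagonal h' he.symm).2.1.ge
    · exact ih h' (by omega)
  | @bump_down i j h1 h2 ih =>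
    intro s' i' j' h' e
    by_cases he : i' + j = i + 1 + j'
    · exact ((Enters.bump_down h1 h2).eq_of_diagonal h' he.symm).2.1.ge
    · exact (ih h' (by omega)).trans (by omega)

/-- One step backwards, to the preceding diagonal. In terms of ranks, a bump adds 1, a crossing adds
2 from the top and 0 from the right. -/
theorem Enters.eq_start_or_prev {s : Side} (h : Enters P c s i j) :
    (s = Side.top ∧ i = 0 ∧ j = c) ∨
    ∃ s₁ i₁ j₁, Enters P c s₁ i₁ j₁ ∧ i + j₁ = i₁ + j + 1 ∧
      ((P i₁ j₁ ≠ Tile.cross ∧ s.rank i = s₁.rank i₁ + 1) ∨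
       (P i₁ j₁ = Tile.cross ∧ s₁ = Side.top ∧ s.rank i = 2 * i₁ + 2) ∨
       (P i₁ j₁ = Tile.cross ∧ s₁ = Side.right ∧ s.rank i = 2 * i₁ + 1)) := by
  cases h with
  | start => simp
  | @cross_down i _ h1 h2 =>
    exact Or.inr ⟨_, _, _, h1, by omega, Or.inr (Or.inl ⟨h2, rfl, by simp [Side.rank]; omega⟩)⟩
  | bump_left h1 h2 =>
    exact Or.inr ⟨_, _, _, h1, by omega, Or.inl ⟨h2, by simp [Side.rank]⟩⟩
  | cross_left h1 h2 =>
    exact Or.inr ⟨_, _, _, h1, by omega, Or.inr (Or.inr ⟨h2, rfl, by simp [Side.rank]⟩)⟩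
  | @bump_down i _ h1 h2 =>
    exact Or.inr ⟨_, _, _, h1, by omega, Or.inl ⟨h2, by simp [Side.rank]; omega⟩⟩

theorem Side.rank_bounds (s : Side) (i : ℕ) : 2 * i ≤ s.rank i ∧ s.rank i ≤ 2 * i + 1 := by
  cases s <;> simp [Side.rank]

theorem Enters.rank_pos_of_diagonal {x y : ℕ} {s : Side} (h : Enters P x s i j) (hxy : y < x)
    (he : i + y = j) : 0 < s.rank i := by
  cases h with
  | start => omega
  | cross_down h1 h2 => simp [Side.rank]
  | bump_left h1 h2 => simp [Side.rank]
  | cross_left h1 h2 => simp [Side.rank]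
  | bump_down h1 h2 => simp [Side.rank]

/-- If the pipe `x` that starts to the right of the pipe `y` lies before `y` on some diagonal,
then the two pipes have crossed. -/
theorem rank_lt_or_crossAt {x y : ℕ} (hxy : y < x) {s s' : Side} {i j i' j' : ℕ}
    (h : Enters P x s i j) (h' : Enters P y s' i' j') (he : i + j' = i' + j) :
    s'.rank i' < s.rank i ∨
      ∃ i₀ j₀, CrossAt P x y i₀ j₀ ∧ i₀ ≤ i ∧ i₀ < i' ∧ i₀ + j < i + j₀ := by
  -- Here `n` is the number of steps that `x` has made. For `n = 0` the diagonal is the one where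
  -- `x` starts, which `y < x` never meets.
  obtain ⟨n, hn⟩ : ∃ n, i + x = n + j := ⟨i + x - j, by have := h.le_add_label; omega⟩
  induction n generalizing s s' i j i' j' with
  | zero =>
    have := h.le_add_label
    have := h'.le_add_label
    omega
  | succ n ih =>
    rcases h'.eq_start_or_prev with ⟨rfl, rfl, rfl⟩ | ⟨s₂, i₂, j₂, h₂, e₂, r₂⟩
    · exact Or.inl (by have := h.rank_pos_of_diagonal hxy (by omega); simpa [Side.rank] using this)
    rcases h.eq_start_or_prev with ⟨rfl, rfl, rfl⟩ | ⟨s₁, i₁, j₁, h₁, e₁, r₁⟩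
    · omega
    have b := s.rank_bounds i
    have b' := s'.rank_bounds i'
    have b₁ := s₁.rank_bounds i₁
    have b₂ := s₂.rank_bounds i₂
    rcases ih h₁ h₂ (by omega) (by omega) with hlt | ⟨i₀, j₀, hc, ha, hb, hd⟩
    -- Only pipes that share the tile on the preceding diagonal can change their order.
    · by_cases ht : i₁ = i₂
      · subst ht
        obtain rfl : j₁ = j₂ := by omega
        obtain ⟨rfl, rfl⟩ : s₁ = Side.right ∧ s₂ = Side.top := by
          cases s₁ <;> cases s₂ <;> simp [Side.rank] at hlt ⊢
        by_cases hx : P i₁ j₁ = Tile.cross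
        · simp [hx] at r₁ r₂
          exact Or.inr ⟨i₁, j₁, ⟨hx, Or.inr ⟨h₂, h₁⟩⟩, by omega, by omega, by omega⟩
        · simp [hx] at r₁ r₂
          omega
      · left
        omega
    · refine Or.inr ⟨i₀, j₀, hc, ?_, ?_, by omega⟩ <;> omega

theorem CrossAt.tile_eq {x y i₁ j₁ i₂ j₂ i₀ j₀ : ℕ} {s₁ s₂ : Side} (hc : CrossAt P x y i₀ j₀)
    (h₁ : Enters P x s₁ i₁ j₁) (h₂ : Enters P y s₂ i₂ j₂)
    (e₁ : i₁ + j₀ = i₀ + j₁) (e₂ : i₂ + j₀ = i₀ + j₂) :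
    i₁ = i₀ ∧ j₁ = j₀ ∧ i₂ = i₀ ∧ j₂ = j₀ := by
  obtain ⟨-, ⟨ha, hb⟩ | ⟨hb, ha⟩⟩ := hc <;>
  · have := h₁.eq_of_diagonal ha e₁
    have := h₂.eq_of_diagonal hb e₂
    tauto

/-- Suppose that in every crossing tile the pipe from the top starts to the left of the pipe from
the right. Then on every diagonal on which pipe `x` comes after pipe `y`, where `y` starts to the
left of `x`, the two pipes have not crossed yet. -/
theorem rank_lt_or_gt
    (hP : ∀ i j x y, Enters P x Side.top i j → Enters P y Side.right i j →
      P i j = Tile.cross → x < y)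
    {x y : ℕ} (hxy : y < x) {s s' : Side} {i j i' j' : ℕ}
    (h : Enters P x s i j) (h' : Enters P y s' i' j') (he : i + j' = i' + j) :
    (s'.rank i' < s.rank i ∧ ∀ i₀ j₀, CrossAt P x y i₀ j₀ → i + j₀ ≤ i₀ + j) ∨
      s.rank i < s'.rank i' := by
  obtain ⟨n, hn⟩ : ∃ n, i + x = n + j := ⟨i + x - j, by have := h.le_add_label; omega⟩
  induction n generalizing s s' i j i' j' with
  | zero =>
    have := h.le_add_label
    have := h'.le_add_label
    omega
  | succ n ih =>
    rcases h'.eq_start_or_prev with ⟨rfl, rfl, rfl⟩ | ⟨s₂, i₂, j₂, h₂, e₂, r₂⟩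
    · refine Or.inl ⟨?_, ?_⟩
      · have := h.rank_pos_of_diagonal hxy (by omega)
        simpa [Side.rank] using this
      · rintro i₀ j₀ ⟨-, ⟨-, ha⟩ | ⟨ha, -⟩⟩ <;>
        · have := ha.le_add_label
          omega
    rcases h.eq_start_or_prev with ⟨rfl, rfl, rfl⟩ | ⟨s₁, i₁, j₁, h₁, e₁, r₁⟩
    · omega
    have b := s.rank_bounds i
    have b' := s'.rank_bounds i'
    have b₁ := s₁.rank_bounds i₁
    have b₂ := s₂.rank_bounds i₂
    rcases ih h₁ h₂ (by omega) (by omega) with ⟨hlt, hno⟩ | hgt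
    · have step : ∀ i₀ j₀, CrossAt P x y i₀ j₀ → i₀ + j < i + j₀ →
          i₁ = i₂ ∧ P i₁ j₁ = Tile.cross := by
        intro i₀ j₀ hc hlt
        have := hno i₀ j₀ hc
        obtain ⟨rfl, rfl, rfl, rfl⟩ := hc.tile_eq h₁ h₂ (by omega) (by omega)
        exact ⟨rfl, hc.1⟩
      by_cases ht : i₁ = i₂
      · subst ht
        obtain rfl : j₁ = j₂ := by omega
        obtain ⟨rfl, rfl⟩ : s₁ = Side.right ∧ s₂ = Side.top := by
          cases s₁ <;> cases s₂ <;> simp [Side.rank] at hlt ⊢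
        by_cases hx : P i₁ j₁ = Tile.cross
        · simp [hx] at r₁ r₂
          exact Or.inr (by omega)
        · simp [hx] at r₁ r₂
          refine Or.inl ⟨by omega, fun i₀ j₀ hc => ?_⟩
          by_contra hcon
          exact hx (step i₀ j₀ hc (by omega)).2
      · refine Or.inl ⟨by omega, fun i₀ j₀ hc => ?_⟩
        by_contra hcon
        exact ht (step i₀ j₀ hc (by omega)).1
    · right
      by_cases ht : i₁ = i₂
      · subst ht
        obtain rfl : j₁ = j₂ := by omega
        obtain ⟨rfl, rfl⟩ : s₁ = Side.top ∧ s₂ = Side.right := by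
          cases s₁ <;> cases s₂ <;> simp [Side.rank] at hgt ⊢
        have hx : P i₁ j₁ ≠ Tile.cross := fun hx => by
          have := hP _ _ _ _ h₁ h₂ hx
          omega
        simp [hx] at r₁ r₂
        omega
      · omega

/-! ### Reducedness and marks as local conditions -/

/-- In every crossing tile the pipe from the top starts to the left of the pipe from the right, in
every marked tile it starts to the right of it. -/
def LocallyValid (P : Filling) : Prop :=
  ∀ i j x y, Enters P x Side.top i j → Enters P y Side.right i j →
    (P i j = Tile.cross → x < y) ∧ (P i j = Tile.marked → y < x)

/-- A crossing with the wrong labels occurs between pipes whose order is already reversed, so they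
cross a second time. A marked tile with the wrong labels would meet two pipes in their original
order, which therefore have not crossed yet. -/
theorem IsMRPD.locallyValid {v : List ℕ} (h : IsMRPD v P) : LocallyValid P := by
  have hpad : Padded v.length P := h.staircase
  have hne : ∀ {i j x y}, Enters P x Side.top i j → Enters P y Side.right i j → x ≠ y := by
    rintro i j x y h1 h2 rfl
    cases (h1.eq_of_diagonal h2 rfl).1
  have hcross : ∀ i j x y, Enters P x Side.top i j → Enters P y Side.right i j →
      P i j = Tile.cross → x < y := by
    intro i j x y h1 h2 hx
    by_contra hcon
    have hn := hne h1 h2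
    rcases rank_lt_or_crossAt (show y < x by omega) h1 h2 rfl with hlt | ⟨i₀, j₀, hc, -, hi, -⟩
    · simp [Side.rank] at hlt
    · have := h.reduced x (h1.lt_of_ne_bump hpad (by simp [hx])) y
        (h2.lt_of_ne_bump hpad (by simp [hx])) hn i j i₀ j₀ ⟨hx, Or.inl ⟨h1, h2⟩⟩ hc
      omega
  intro i j x y h1 h2
  refine ⟨hcross i j x y h1 h2, fun hm => ?_⟩
  by_contra hcon
  have hlt : x < y := by have := hne h1 h2; omega
  obtain ⟨c, -, d, -, -, hmeet, i', hi', j', hc⟩ := h.marked i j hm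
  replace hc : CrossAt P y x i' j' := by
    rcases hmeet with ⟨h3, h4⟩ | ⟨h3, h4⟩
    · rw [h1.label_unique h3, h2.label_unique h4]
      exact ⟨hc.1, hc.2.symm⟩
    · rwa [h1.label_unique h3, h2.label_unique h4]
  rcases rank_lt_or_gt hcross hlt h2 h1 rfl with ⟨-, hno⟩ | hgt
  · have hle := hno i' j' hc
    obtain ⟨-, ⟨h3, -⟩ | ⟨-, h3⟩⟩ := hc <;>
    · have := h3.row_mono h2 hle
      omega
  · simp [Side.rank] at hgt

/-- Every crossing turns the original order into the reversed one, so none is preceded by another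
crossing of the same two pipes. In a marked tile the order is already reversed, which requires a
crossing above. -/
theorem LocallyValid.isMRPD {v : List ℕ} (h : LocallyValid P) (hpad : Padded v.length P)
    (hword : ∀ (i : ℕ) (hi : i < v.length), Exits P (entryCol v v[i]) i) : IsMRPD v P where
  staircase := hpad
  word := hword
  reduced := by
    have hcross := fun i j x y h1 h2 => (h i j x y h1 h2).1
    have first : ∀ x y, y < x → ∀ i j i' j', CrossAt P x y i j → CrossAt P x y i' j' →
        i + j' ≤ i' + j := by
      rintro x y hxy i j i' j' ⟨hx, ⟨h1, h2⟩ | ⟨h1, h2⟩⟩ hc'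
      · have := hcross i j x y h1 h2 hx
        omega
      · rcases rank_lt_or_gt hcross hxy h2 h1 rfl with ⟨-, hno⟩ | hgt
        · exact hno _ _ hc'
        · simp [Side.rank] at hgt
    have main : ∀ x y, y < x → ∀ i j i' j', CrossAt P x y i j → CrossAt P x y i' j' →
        i = i' ∧ j = j' := by
      intro x y hxy i j i' j' hc hc'
      have e1 := first x y hxy i j i' j' hc hc'
      have e2 := first x y hxy i' j' i j hc' hc
      obtain ⟨-, ⟨h1, h2⟩ | ⟨h1, h2⟩⟩ := hc
      · have := hc'.tile_eq h1 h2 (by omega) (by omega)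
        tauto
      · have := hc'.tile_eq h2 h1 (by omega) (by omega)
        tauto
    intro c _ d _ hcd i j i' j' h1 h2
    rcases Nat.lt_or_gt_of_ne hcd with hlt | hlt
    · exact main d c hlt i j i' j' ⟨h1.1, h1.2.symm⟩ ⟨h2.1, h2.2.symm⟩
    · exact main c d hlt i j i' j' h1 h2
  marked := by
    intro i j hm
    obtain ⟨x, hx⟩ := hpad.exists_enters Side.top i j
    obtain ⟨y, hy⟩ := hpad.exists_enters Side.right i j
    have hlt := (h i j x y hx hy).2 hm
    refine ⟨x, hx.lt_of_ne_bump hpad (by simp [hm]), y, hy.lt_of_ne_bump hpad (by simp [hm]),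
      by omega, Or.inl ⟨hx, hy⟩, ?_⟩
    rcases rank_lt_or_crossAt hlt hx hy rfl with hr | ⟨i₀, j₀, hc, -, hi, -⟩
    · simp [Side.rank] at hr
    · exact ⟨i₀, hi, j₀, hc⟩

/-! ### Insertion of a pipe, as a relation -/

variable {e : ℕ → ℕ}

/-- The increasing enumeration of the natural numbers other than `c`. -/
def skip (c d : ℕ) : ℕ := if d < c then d else d + 1

theorem skip_of_lt (h : d < c) : skip c d = d := if_pos h

theorem skip_of_le (h : c ≤ d) : skip c d = d + 1 := if_neg (by omega)

theorem skip_lt_skip {x y : ℕ} : skip c x < skip c y ↔ x < y := by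
  unfold skip; split_ifs <;> omega

theorem skip_injective (c : ℕ) : Function.Injective (skip c) := by
  intro x y; unfold skip; split_ifs <;> omega

theorem exists_skip_of_ne (h : d ≠ c) : ∃ x, skip c x = d := by
  rcases Nat.lt_or_gt_of_ne h with h | h
  · exact ⟨d, skip_of_lt h⟩
  · exact ⟨d - 1, by rw [skip_of_le (by omega)]; omega⟩

/-- `P` arises from `Q` by the insertion of a removable pipe in column `c`, where `e j` is the row
in which the inserted pipe leaves column `j`. -/
structure IsInsertion (Q P : Filling) (c : ℕ) (e : ℕ → ℕ) : Prop where
  right : ∀ i j, c ≤ j → P i (j + 1) = Q i j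
  entry_cross : ∀ i, i < e c → P i c = Tile.cross
  entry_bump : ∀ i, e c ≤ i → P i c = Tile.bump
  step : ∀ j, j < c →
    (e j = e (j + 1) ∧ P (e j) j = Tile.cross ∧ ∀ i, e j = i + 1 → Q i j ≠ Tile.bump) ∨
    (e j = e (j + 1) + 1 ∧ Q (e (j + 1)) j = Tile.bump)
  above : ∀ i j, j < c → i < e j → P i j = Q i j
  below : ∀ i j, j < c → e (j + 1) ≤ i → P (i + 1) j = Q i j

namespace IsInsertion

theorem le (h : IsInsertion Q P c e) (hj : j < c) : e (j + 1) ≤ e j ∧ e j ≤ e (j + 1) + 1 := by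
  rcases h.step j hj with ⟨h1, -⟩ | ⟨h1, -⟩ <;> omega

theorem bumps (h : IsInsertion Q P c e) (hj : j < c) (he : e j ≠ e (j + 1)) :
    e j = e (j + 1) + 1 ∧ Q (e (j + 1)) j = Tile.bump ∧ P (e (j + 1)) j = Tile.bump ∧
      P (e j) j = Tile.bump := by
  rcases h.step j hj with ⟨h1, -⟩ | ⟨h1, h2⟩
  · exact absurd h1 he
  · refine ⟨h1, h2, ?_, ?_⟩
    · rw [h.above _ _ hj (by omega), h2]
    · rw [h1, h.below _ _ hj le_rfl, h2]

theorem cross (h : IsInsertion Q P c e) (hj : j < c) (he : e j = e (j + 1)) :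
    P (e j) j = Tile.cross ∧ ∀ i, e j = i + 1 → Q i j ≠ Tile.bump := by
  rcases h.step j hj with ⟨_, h2⟩ | ⟨h1, h2⟩
  · exact h2
  · omega

theorem leavesLeft_entry (h : IsInsertion Q P c e) (hd : Enters P d Side.right i c) :
    LeavesLeft P d (skip (e c) i) c := by
  rcases Nat.lt_or_ge i (e c) with hi | hi
  · rw [skip_of_lt hi]
    exact Or.inr ⟨hd, h.entry_cross i hi⟩
  · rw [skip_of_le hi]
    refine Or.inl ⟨.bump_down hd ?_, ?_⟩ <;> rw [h.entry_bump _ (by omega)] <;> simp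

theorem leavesLeft_of_enters (h : IsInsertion Q P c e) (hj : j < c)
    (hd : (Enters P d Side.top (skip (e j) i) j ∧ Q i j ≠ Tile.cross) ∨
      (Enters P d Side.right (skip (e (j + 1)) i) j ∧ Q i j = Tile.cross)) :
    LeavesLeft P d (skip (e j) i) j := by
  have hle := h.le hj
  rcases hd with ⟨hd, hx⟩ | ⟨hd, hx⟩
  · refine Or.inl ⟨hd, ?_⟩
    rcases Nat.lt_or_ge i (e j) with hi | hi
    · rwa [skip_of_lt hi, h.above _ _ hj hi]
    · rwa [skip_of_le hi, h.below _ _ hj (by omega)]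
  · refine Or.inr ?_
    rcases Nat.lt_or_ge i (e (j + 1)) with hi | hi
    · rw [skip_of_lt hi] at hd
      rw [skip_of_lt (by omega), h.above _ _ hj (by omega)]
      exact ⟨hd, hx⟩
    · have : e j ≤ i := by
        by_contra hcon
        obtain ⟨_, h2, -⟩ := h.bumps hj (by omega)
        rw [show e (j + 1) = i by omega, hx] at h2
        cases h2
      rw [skip_of_le hi] at hd
      rw [skip_of_le this, h.below _ _ hj hi]
      exact ⟨hd, hx⟩

/-- The position in `P` of an edge of column `j < c` of `Q`. -/
def _root_.PipeDream.Side.shift (e : ℕ → ℕ) (j i : ℕ) : Side → ℕ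
  | Side.top => skip (e j) i
  | Side.right => skip (e (j + 1)) i

/-- To the left of `c`, the new pipe pushes the edges of `Q` from its own row on down by one. A top
edge of `Q` in row `e j` that is cut by a new crossing is sent to the part below the crossing. -/
theorem enters_aux (h : IsInsertion Q P c e) {s : Side} (hd : Enters Q d s i j) :
    (c ≤ j → Enters P (skip c d) s i (j + 1)) ∧
      (j < c → Enters P (skip c d) s (s.shift e j i) j) := by
  induction hd with
  | start =>
    refine ⟨fun hc => ?_, fun hc => ?_⟩
    · rw [skip_of_le hc]
      exact .start
    · rw [skip_of_lt hc]
      change Enters P d Side.top (skip (e d) 0) d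
      -- If the new pipe runs along row 0 here, pipe `d` passes through its crossing tile first.
      by_cases he : e d = 0
      · rw [he, skip_of_le le_rfl]
        have := h.le hc
        have hx := (h.cross hc (by omega)).1
        rw [he] at hx
        exact .cross_down .start hx
      · rw [skip_of_lt (by omega)]
        exact .start
  | @cross_down i j h1 h2 ih =>
    refine ⟨fun hc => .cross_down (ih.1 hc) (by rw [h.right _ _ hc, h2]), fun hc => ?_⟩
    have ih : Enters P (skip c d) Side.top (skip (e j) i) j := ih.2 hc
    change Enters P (skip c d) Side.top (skip (e j) (i + 1)) j
    have hle := h.le hc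
    rcases Nat.lt_or_ge i (e j) with hi | hi
    · rw [skip_of_lt hi] at ih
      have ih' := ih.cross_down (by rw [h.above _ _ hc hi, h2])
      rcases Nat.lt_or_ge (i + 1) (e j) with hi' | hi'
      · rwa [skip_of_lt hi']
      · rw [skip_of_le hi']
        by_cases he : e j = e (j + 1)
        · have hx := (h.cross hc he).1
          rw [show e j = i + 1 by omega] at hx
          exact ih'.cross_down hx
        · obtain ⟨h3, h4, -⟩ := h.bumps hc he
          rw [show e (j + 1) = i by omega, h2] at h4
          cases h4
    · rw [skip_of_le hi] at ih
      rw [skip_of_le (c := e j) (by omega)]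
      exact ih.cross_down (by rw [h.below _ _ hc (by omega), h2])
  | @bump_left i j h1 h2 ih =>
    refine ⟨fun hc => .bump_left (ih.1 (by omega)) (by rwa [h.right _ _ (by omega)]),
      fun hc => ?_⟩
    change Enters P (skip c d) Side.right (skip (e (j + 1)) i) j
    rw [enters_right_iff]
    by_cases hc' : j + 1 < c
    · exact h.leavesLeft_of_enters hc' (Or.inl ⟨ih.2 hc', h2⟩)
    · obtain rfl : c = j + 1 := by omega
      refine h.leavesLeft_entry (.bump_left (ih.1 le_rfl) ?_)
      rwa [h.right _ _ le_rfl]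
  | @cross_left i j h1 h2 ih =>
    refine ⟨fun hc => .cross_left (ih.1 (by omega)) (by rwa [h.right _ _ (by omega)]),
      fun hc => ?_⟩
    change Enters P (skip c d) Side.right (skip (e (j + 1)) i) j
    rw [enters_right_iff]
    by_cases hc' : j + 1 < c
    · exact h.leavesLeft_of_enters hc' (Or.inr ⟨ih.2 hc', h2⟩)
    · obtain rfl : c = j + 1 := by omega
      refine h.leavesLeft_entry (.cross_left (ih.1 le_rfl) ?_)
      rwa [h.right _ _ le_rfl]
  | @bump_down i j h1 h2 ih =>
    refine ⟨fun hc => .bump_down (ih.1 hc) (by rwa [h.right _ _ hc]), fun hc => ?_⟩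
    have ih : Enters P (skip c d) Side.right (skip (e (j + 1)) i) j := ih.2 hc
    change Enters P (skip c d) Side.top (skip (e j) (i + 1)) j
    have hle := h.le hc
    rcases Nat.lt_or_ge i (e (j + 1)) with hi | hi
    · rw [skip_of_lt hi] at ih
      have ih' := ih.bump_down (by rwa [h.above _ _ hc (by omega)])
      rcases Nat.lt_or_ge (i + 1) (e j) with hi' | hi'
      · rwa [skip_of_lt hi']
      · rw [skip_of_le hi']
        have hx := (h.cross hc (by omega)).1
        rw [show e j = i + 1 by omega] at hx
        exact ih'.cross_down hx
    · rw [skip_of_le hi] at ih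
      rw [skip_of_le (c := e j) (by omega)]
      exact ih.bump_down (by rwa [h.below _ _ hc hi])

/-- The converse comes from uniqueness: some pipe of `Q` uses the edge, and its image in `P` must be
the given pipe. -/
theorem enters_succ_iff (h : IsInsertion Q P c e) (hQ : Padded m Q) {s : Side} (hj : c ≤ j) :
    Enters P (skip c d) s i (j + 1) ↔ Enters Q d s i j := by
  refine ⟨fun hd => ?_, fun hd => (h.enters_aux hd).1 hj⟩
  obtain ⟨x, hx⟩ := hQ.exists_enters s i j
  rwa [skip_injective c (hd.label_unique ((h.enters_aux hx).1 hj))]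

theorem enters_shift_iff (h : IsInsertion Q P c e) (hQ : Padded m Q) {s : Side} (hj : j < c) :
    Enters P (skip c d) s (s.shift e j i) j ↔ Enters Q d s i j := by
  refine ⟨fun hd => ?_, fun hd => (h.enters_aux hd).2 hj⟩
  obtain ⟨x, hx⟩ := hQ.exists_enters s i j
  rwa [skip_injective c (hd.label_unique ((h.enters_aux hx).2 hj))]

theorem enters_above_iff (h : IsInsertion Q P c e) (hQ : Padded m Q) {s : Side} (hj : j < c)
    (hi : i < e (j + 1)) : Enters P (skip c d) s i j ↔ Enters Q d s i j := by
  have := h.le hj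
  rw [← h.enters_shift_iff hQ hj]
  cases s <;> simp only [Side.shift]
  · rw [skip_of_lt (c := e j) (by omega)]
  · rw [skip_of_lt hi]

theorem enters_below_iff (h : IsInsertion Q P c e) (hQ : Padded m Q) {s : Side} (hj : j < c)
    (hi : e j ≤ i) : Enters P (skip c d) s (i + 1) j ↔ Enters Q d s i j := by
  have := h.le hj
  rw [← h.enters_shift_iff hQ hj]
  cases s <;> simp only [Side.shift]
  · rw [skip_of_le hi]
  · rw [skip_of_le (c := e (j + 1)) (by omega)]

theorem exits (h : IsInsertion Q P c e) (hd : Exits Q d i) :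
    Exits P (skip c d) (skip (e 0) i) := by
  by_cases hc : 0 < c
  · refine h.leavesLeft_of_enters hc (Or.imp ?_ ?_ hd)
    · exact fun hd => ⟨(h.enters_aux hd.1).2 hc, hd.2⟩
    · exact fun hd => ⟨(h.enters_aux hd.1).2 hc, hd.2⟩
  · obtain rfl : c = 0 := by omega
    refine h.leavesLeft_entry ?_
    rcases hd with ⟨h1, h2⟩ | ⟨h1, h2⟩
    · exact .bump_left ((h.enters_aux h1).1 le_rfl) (by rwa [h.right _ _ le_rfl])
    · exact .cross_left ((h.enters_aux h1).1 le_rfl) (by rwa [h.right _ _ le_rfl])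

theorem exits_iff (h : IsInsertion Q P c e) (hQ : Padded m Q) :
    Exits P (skip c d) (skip (e 0) i) ↔ Exits Q d i := by
  refine ⟨fun hd => ?_, h.exits⟩
  obtain ⟨x, hx⟩ := hQ.exists_leavesLeft i 0
  rwa [skip_injective c (LeavesLeft.label_unique hd (h.exits hx))]

theorem enters_entry (h : IsInsertion Q P c e) (hi : i ≤ e c) : Enters P c Side.top i c := by
  induction i with
  | zero => exact .start
  | succ i ih => exact .cross_down (ih (by omega)) (h.entry_cross i (by omega))

theorem leavesLeft (h : IsInsertion Q P c e) (hj : j ≤ c) : LeavesLeft P c (e j) j := by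
  induction hj using Nat.decreasingInduction with
  | self => exact Or.inl ⟨h.enters_entry le_rfl, by rw [h.entry_bump _ le_rfl]; simp⟩
  | of_succ j hj ih =>
    have ih := enters_right_iff.2 ih
    by_cases he : e j = e (j + 1)
    · exact Or.inr ⟨by rwa [he], (h.cross hj he).1⟩
    · obtain ⟨h1, -, h2, h3⟩ := h.bumps hj he
      have := ih.bump_down (by rw [h2]; simp)
      rw [← h1] at this
      exact Or.inl ⟨this, by rw [h3]; simp⟩

theorem enters_right (h : IsInsertion Q P c e) (hj : j < c) :
    Enters P c Side.right (e (j + 1)) j :=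
  enters_right_iff.2 (h.leavesLeft hj)

/-- The complete list of edges of the inserted pipe: its entry column, then in each further column
one right edge and, at a split, one top edge. -/
theorem trace (h : IsInsertion Q P c e) {s : Side} (hd : Enters P c s i j) :
    (s = Side.top ∧ j = c ∧ i ≤ e c) ∨ (s = Side.right ∧ j < c ∧ i = e (j + 1)) ∨
      (s = Side.top ∧ j < c ∧ i = e j ∧ e j = e (j + 1) + 1) := by
  induction hd with
  | start => simp
  | @cross_down i j h1 h2 ih =>
    rcases ih with ⟨-, rfl, hi⟩ | ⟨h, -⟩ | ⟨-, hj, hi, he⟩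
    · refine Or.inl ⟨rfl, rfl, ?_⟩
      by_contra hcon
      rw [h.entry_bump i (by omega)] at h2
      cases h2
    · cases h
    · rw [hi, (h.bumps hj (by omega)).2.2.2] at h2
      cases h2
  | @bump_left i j h1 h2 ih =>
    refine Or.inr (Or.inl ⟨rfl, ?_⟩)
    rcases ih with ⟨-, rfl, hi⟩ | ⟨h, -⟩ | ⟨-, hj, hi, he⟩
    · refine ⟨by omega, ?_⟩
      by_contra hcon
      exact h2 (h.entry_cross i (by omega))
    · cases h
    · exact ⟨by omega, hi⟩
  | @cross_left i j h1 h2 ih =>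
    refine Or.inr (Or.inl ⟨rfl, ?_⟩)
    rcases ih with ⟨h, -⟩ | ⟨-, hj, rfl⟩ | ⟨h, -⟩
    · cases h
    · refine ⟨by omega, ?_⟩
      by_contra hcon
      rw [(h.bumps hj (Ne.symm hcon)).2.2.1] at h2
      cases h2
    · cases h
  | @bump_down i j h1 h2 ih =>
    refine Or.inr (Or.inr ⟨rfl, ?_⟩)
    rcases ih with ⟨h, -⟩ | ⟨-, hj, rfl⟩ | ⟨h, -⟩
    · cases h
    · have hne : e j ≠ e (j + 1) := fun he => by
        have hx := (h.cross hj he).1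
        rw [he] at hx
        exact h2 hx
      have := (h.bumps hj hne).1
      exact ⟨hj, this.symm, this⟩
    · cases h

theorem removableCol (h : IsInsertion Q P c e) : RemovableCol P c where
  entry_cross := by
    intro i hi
    refine Or.inl (h.enters_entry ?_)
    by_contra hcon
    rw [h.entry_bump i (by omega)] at hi
    cases hi
  entry_unmarked := by
    intro i
    rcases Nat.lt_or_ge i (e c) with hi | hi
    · rw [h.entry_cross i hi]; simp
    · rw [h.entry_bump i hi]; simp
  above_cross := by
    have key : ∀ {s : Side} i j, P (i + 1) j = Tile.cross → Enters P c s (i + 1) j →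
        P i j ≠ Tile.bump := by
      intro s i j hx hd
      rcases h.trace hd with ⟨-, rfl, hi⟩ | ⟨-, hj, hi⟩ | ⟨-, hj, hi, he⟩
      · rw [h.entry_cross i (by omega)]; simp
      · by_cases he : e j = e (j + 1)
        · rw [h.above _ _ hj (by omega)]
          exact (h.cross hj he).2 i (by omega)
        · rw [hi, (h.bumps hj he).2.2.1] at hx
          cases hx
      · rw [hi, (h.bumps hj (by omega)).2.2.2] at hx
        cases hx
    rintro i j hx (hd | hd)
    · exact key i j hx hd
    · exact key i j hx hd
  unmarked := by
    have key : ∀ {s : Side} i j, Enters P c s i j → P i j ≠ Tile.marked := by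
      intro s i j hd
      rcases h.trace hd with ⟨-, rfl, hi⟩ | ⟨-, hj, hi⟩ | ⟨-, hj, hi, he⟩
      · rcases Nat.lt_or_ge i (e j) with hi | hi
        · rw [h.entry_cross i hi]; simp
        · rw [h.entry_bump i hi]; simp
      · by_cases he : e j = e (j + 1)
        · rw [hi, ← he, (h.cross hj he).1]; simp
        · rw [hi, (h.bumps hj he).2.2.1]; simp
      · rw [hi, (h.bumps hj (by omega)).2.2.2]; simp
    rintro i j (hd | hd)
    · exact key i j hd
    · exact key i j hd

theorem deleteCol_eq (h : IsInsertion Q P c e) : deleteCol P c = Q := by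
  funext i j
  unfold deleteCol
  by_cases hj : c ≤ j
  · rw [if_pos hj, h.right _ _ hj]
  · rw [if_neg hj]
    replace hj : j < c := by omega
    have row : ∀ {k}, Enters P c Side.right k j → k = e (j + 1) := by
      intro k hk
      rcases h.trace hk with ⟨h, -⟩ | ⟨-, -, h⟩ | ⟨h, -⟩
      · cases h
      · exact h
      · cases h
    have hle := h.le hj
    split_ifs with h1 h2
    · obtain ⟨h1, h2⟩ := h1
      rw [row h1] at h2 ⊢
      by_cases he : e j = e (j + 1)
      · have := (h.cross hj he).1
        rw [he] at this
        exact absurd this h2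
      · exact (h.bumps hj he).2.1.symm
    · obtain ⟨k, hk, h2⟩ := h2
      rw [row h2] at hk
      exact h.below _ _ hj hk
    · refine h.above _ _ hj ?_
      by_contra hcon
      exact h2 ⟨_, by omega, h.enters_right hj⟩

/-- Given `e j`, the tile of `Q` directly above decides whether the route rises: it does exactly if
this tile is an unmarked bump. This is where condition (ii) of removability gives injectivity. -/
theorem rows_unique {P' : Filling} {e' : ℕ → ℕ} (h : IsInsertion Q P c e)
    (h' : IsInsertion Q P' c e') (h0 : e 0 = e' 0) (hj : j ≤ c) : e j = e' j := by
  induction j with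
  | zero => exact h0
  | succ j ih =>
    have ih := ih (by omega)
    rcases h.step j hj with ⟨h1, -, h2⟩ | ⟨h1, h2⟩ <;>
      rcases h'.step j hj with ⟨h3, -, h4⟩ | ⟨h3, h4⟩
    · omega
    · exact absurd h4 (h2 _ (by omega))
    · exact absurd h2 (h4 _ (by omega))
    · omega

theorem unique {P' : Filling} {e' : ℕ → ℕ} (h : IsInsertion Q P c e)
    (h' : IsInsertion Q P' c e') (h0 : e 0 = e' 0) : P = P' := by
  have he := fun j hj => h.rows_unique (j := j) h' h0 hj
  funext i j
  rcases Nat.lt_trichotomy j c with hj | rfl | hj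
  · have hle := h.le hj
    have e1 := he j (by omega)
    have e2 := he (j + 1) hj
    rcases Nat.lt_trichotomy i (e j) with hi | rfl | hi
    · rw [h.above _ _ hj hi, h'.above _ _ hj (by omega)]
    · by_cases hx : e j = e (j + 1)
      · have := (h'.cross hj (by omega)).1
        rw [(h.cross hj hx).1, e1, this]
      · have := (h'.bumps hj (by omega)).2.2.2
        rw [(h.bumps hj hx).2.2.2, e1, this]
    · obtain ⟨k, rfl⟩ : ∃ k, i = k + 1 := ⟨i - 1, by omega⟩
      rw [h.below _ _ hj (by omega), h'.below _ _ hj (by omega)]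
  · have := he j le_rfl
    rcases Nat.lt_or_ge i (e j) with hi | hi
    · rw [h.entry_cross _ hi, h'.entry_cross _ (by omega)]
    · rw [h.entry_bump _ hi, h'.entry_bump _ (by omega)]
  · obtain ⟨k, rfl⟩ : ∃ k, j = k + 1 := ⟨j - 1, by omega⟩
    rw [h.right _ _ (by omega), h'.right _ _ (by omega)]

end IsInsertion

/-! ### Removable pipes are inserted pipes, and insertions exist -/

theorem Tile.eq_bump {t : Tile} (h1 : t ≠ Tile.cross) (h2 : t ≠ Tile.marked) : t = Tile.bump := by
  cases t <;> simp at *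

theorem Enters.cross_above (h : Enters P c Side.top i c) :
    ∀ k < i, P k c = Tile.cross := by
  induction i with
  | zero => simp
  | succ i ih =>
    intro k hk
    cases h with
    | cross_down h1 h2 =>
      rcases Nat.lt_succ_iff_lt_or_eq.1 hk with hk | rfl
      · exact ih h1 k hk
      · exact h2
    | bump_down h1 h2 => exact absurd (h1.col_le.2 rfl) (lt_irrefl _)

theorem Traverses.enters_top (h : Traverses P c i c) : Enters P c Side.top i c :=
  h.resolve_right fun h => absurd (h.col_le.2 rfl) (lt_irrefl _)

theorem RemovableCol.exists_isInsertion (h : RemovableCol P c) (hP : Padded m P) :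
    ∃ e, IsInsertion (deleteCol P c) P c e := by
  classical
  obtain ⟨t, -, ht, -⟩ := hP.exists_leavesLeft_of_enters (Enters.start (P := P) (c := c))
  replace ht : Enters P c Side.top t c ∧ P t c ≠ Tile.cross :=
    ht.resolve_right fun h => absurd (h.1.col_le.2 rfl) (lt_irrefl _)
  obtain ⟨ht, htx⟩ := ht
  obtain ⟨e, hec, he⟩ : ∃ e : ℕ → ℕ, e c = t ∧
      ∀ j < c, e j = if P (e (j + 1)) j = Tile.cross then e (j + 1) else e (j + 1) + 1 := by
    -- The route is followed leftwards from column `c`, so the recursion is on the distance `c - j`.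
    let f : ℕ → ℕ := fun k => Nat.rec t
      (fun k r => if P r (c - (k + 1)) = Tile.cross then r else r + 1) k
    refine ⟨fun j => f (c - j), by simp [f], fun j hj => ?_⟩
    obtain ⟨k, hk⟩ : ∃ k, c - j = k + 1 := ⟨c - j - 1, by omega⟩
    have h1 : c - (j + 1) = k := by omega
    have h2 : c - (k + 1) = j := by omega
    simp only [hk, h1]
    simp only [f, h2]
  have tiles : ∀ j < c, Enters P c Side.right (e (j + 1)) j →
      (e j = e (j + 1) ∧ P (e j) j = Tile.cross) ∨
      (e j = e (j + 1) + 1 ∧ P (e (j + 1)) j = Tile.bump ∧ P (e j) j = Tile.bump ∧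
        Enters P c Side.top (e j) j) := by
    intro j hj hd
    have hej := he j hj
    split_ifs at hej with hx
    · exact Or.inl ⟨hej, by rwa [hej]⟩
    · have hb := Tile.eq_bump hx (h.unmarked _ _ (Or.inr hd))
      have hd' := hd.bump_down hx
      refine Or.inr ⟨hej, hb, ?_, by rwa [hej]⟩
      -- The second tile lies below an unmarked bump, so condition (ii) excludes a crossing and
      -- condition (iii) a mark.
      rw [hej]
      exact Tile.eq_bump (fun hx' => h.above_cross _ _ hx' (Or.inl hd') hb)
        (h.unmarked _ _ (Or.inl hd'))
  have left : ∀ j ≤ c, LeavesLeft P c (e j) j := by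
    intro j hj
    induction hj using Nat.decreasingInduction with
    | self => rw [hec]; exact Or.inl ⟨ht, htx⟩
    | of_succ j hj ih =>
      have ih := enters_right_iff.2 ih
      rcases tiles j hj ih with ⟨h1, h2⟩ | ⟨h1, h2, h3, h4⟩
      · exact Or.inr ⟨by rwa [h1], h2⟩
      · exact Or.inl ⟨h4, by rw [h3]; simp⟩
  have right : ∀ j < c, Enters P c Side.right (e (j + 1)) j :=
    fun j hj => enters_right_iff.2 (left (j + 1) hj)
  let Q : Filling := fun i j => if c ≤ j then P i (j + 1) else if i < e j then P i j else P (i + 1) j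
  have hQ : IsInsertion Q P c e :=
    { right := fun i j hj => by simp [Q, hj]
      entry_cross := fun i hi => ht.cross_above i (by omega)
      entry_bump := by
        intro i hi
        refine Tile.eq_bump (fun hx => ?_) (h.entry_unmarked i)
        rcases (hec ▸ hi : t ≤ i).eq_or_lt with rfl | hi
        · exact htx hx
        · exact htx ((h.entry_cross i hx).enters_top.cross_above t hi)
      step := by
        intro j hj
        rcases tiles j hj (right j hj) with ⟨h1, h2⟩ | ⟨h1, h2, -⟩
        · refine Or.inl ⟨h1, h2, fun i hi => ?_⟩
          have hd := right j hj
          rw [← h1, hi] at hd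
          rw [hi] at h2
          simpa [Q, Nat.not_le.2 hj, hi] using h.above_cross i j h2 (Or.inr hd)
        · exact Or.inr ⟨h1, by simpa [Q, Nat.not_le.2 hj, h1] using h2⟩
      above := fun i j hj hi => by simp [Q, Nat.not_le.2 hj, hi]
      below := by
        intro i j hj hi
        rcases tiles j hj (right j hj) with ⟨h1, h2⟩ | ⟨h1, h2, h3, -⟩
        · simp [Q, Nat.not_le.2 hj, h1, Nat.not_lt.2 hi]
        · by_cases hi' : i < e j
          · obtain rfl : i = e (j + 1) := by omega
            rw [h1] at h3
            simp [Q, Nat.not_le.2 hj, h1, h2, h3]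
          · simp [Q, Nat.not_le.2 hj, hi'] }
  exact ⟨e, by rwa [hQ.deleteCol_eq]⟩

/-- The greedy route: start in row `p` at the left boundary, go right, and rise by one row whenever
the tile directly above is an unmarked bump. -/
theorem exists_isInsertion (hQ : Padded m Q) {p c : ℕ} (hp : p ≤ m) (hc : c ≤ m) :
    ∃ P e, IsInsertion Q P c e ∧ e 0 = p ∧ Padded (m + 1) P := by
  classical
  obtain ⟨e, he0, he⟩ : ∃ e : ℕ → ℕ, e 0 = p ∧ ∀ j,
      (e j = e (j + 1) ∧ ∀ i, e j = i + 1 → Q i j ≠ Tile.bump) ∨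
      (e j = e (j + 1) + 1 ∧ Q (e (j + 1)) j = Tile.bump) := by
    obtain ⟨e, he0, hs⟩ : ∃ e : ℕ → ℕ, e 0 = p ∧ ∀ j,
        (e j ≠ 0 ∧ Q (e j - 1) j = Tile.bump → e (j + 1) = e j - 1) ∧
        (¬ (e j ≠ 0 ∧ Q (e j - 1) j = Tile.bump) → e (j + 1) = e j) :=
      ⟨fun k => Nat.rec p
        (fun j (r : ℕ) => if r ≠ 0 ∧ Q (r - 1) j = Tile.bump then r - 1 else r) k,
        rfl, fun j => ⟨fun h => if_pos h, fun h => if_neg h⟩⟩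
    refine ⟨e, he0, fun j => ?_⟩
    by_cases hx : e j ≠ 0 ∧ Q (e j - 1) j = Tile.bump
    · have := (hs j).1 hx
      exact Or.inr ⟨by omega, by rw [this]; exact hx.2⟩
    · refine Or.inl ⟨((hs j).2 hx).symm, fun i hi hb => hx ⟨by omega, ?_⟩⟩
      rwa [hi]
  -- When `e j + j = m` and `e j` is positive, the tile directly above lies on the diagonal of `Q`,
  -- hence is a bump, and the route rises.
  have bound : ∀ j ≤ c, e j + j ≤ m := by
    intro j
    induction j with
    | zero => intro _; omega
    | succ j ih =>
      intro hj
      have ih := ih (by omega)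
      rcases he j with ⟨h1, h2⟩ | ⟨h1, h2⟩
      · rcases Nat.eq_zero_or_pos (e j) with h0 | h0
        · omega
        · by_contra hcon
          exact h2 (e j - 1) (by omega) (hQ _ _ (by omega))
      · omega
  -- At a split `e (j + 1) < e j`, so the last crossing case does not occur and the bump of `Q` in
  -- row `e (j + 1)` is copied to both rows.
  let P : Filling := fun i j => if c < j then Q i (j - 1) else
    if j = c then if i < e c then Tile.cross else Tile.bump else
    if i < e j then Q i j else if i = e (j + 1) then Tile.cross else Q (i - 1) j
  refine ⟨P, e, ⟨?_, ?_, ?_, ?_, ?_, ?_⟩, he0, ?_⟩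
  · intro i j hj
    simp only [P]
    rw [if_pos (by omega)]
    rfl
  · intro i hi
    simp [P, hi]
  · intro i hi
    simp [P, hi]
  · intro j hj
    rcases he j with ⟨h1, h2⟩ | ⟨h1, h2⟩
    · refine Or.inl ⟨h1, ?_, h2⟩
      simp only [P]
      rw [if_neg (by omega), if_neg (by omega), if_neg (by omega), if_pos h1]
    · exact Or.inr ⟨h1, h2⟩
  · intro i j hj hi
    simp only [P]
    rw [if_neg (by omega), if_neg (by omega), if_pos hi]
  · intro i j hj hi
    simp only [P]
    rw [if_neg (by omega), if_neg (by omega)]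
    rcases he j with ⟨h1, h2⟩ | ⟨h1, h2⟩ <;>
      rw [if_neg (by omega), if_neg (by omega)] <;> rfl
  · intro i j hij
    simp only [P]
    split_ifs with h1 h2 h3 h4 h5
    · exact hQ _ _ (by omega)
    · have := bound c le_rfl
      omega
    · rfl
    · exact hQ _ _ (by omega)
    · exfalso
      rcases he j with ⟨h6, h7⟩ | ⟨h6, h7⟩
      · rcases Nat.eq_zero_or_pos (e j) with h0 | h0
        · omega
        · exact h7 (e j - 1) (by omega) (hQ _ _ (by omega))
      · omega
    · exact hQ _ _ (by omega)

/-! ### Transfer of validity and removability -/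

namespace IsInsertion

theorem padded (h : IsInsertion Q P c e) (hP : Padded (m + 1) P) (hc : c ≤ m) : Padded m Q := by
  have bound : ∀ j ≤ c, e j + j ≤ m := by
    intro j hj
    induction hj using Nat.decreasingInduction with
    | self =>
      by_contra hcon
      have h1 := h.entry_cross (e c - 1) (by omega)
      rw [hP _ _ (by omega)] at h1
      cases h1
    | of_succ j hj ih =>
      have := h.le hj
      omega
  intro i j hij
  rcases Nat.lt_or_ge j c with hj | hj
  · rcases Nat.lt_or_ge i (e (j + 1)) with hi | hi
    · have := bound (j + 1) hj
      omega
    · rw [← h.below _ _ hj hi]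
      exact hP _ _ (by omega)
  · rw [← h.right _ _ hj]
    exact hP _ _ (by omega)

theorem bump_between (h : IsInsertion Q P c e) (hj : j < c) (h1 : e (j + 1) ≤ i) (h2 : i < e j) :
    Q i j = Tile.bump := by
  obtain ⟨h3, h4, -⟩ := h.bumps hj (by omega)
  rwa [show i = e (j + 1) by omega]

theorem tile_cases (h : IsInsertion Q P c e) (hj : j < c) (i : ℕ) :
    i < e (j + 1) ∨ (∃ k, i = k + 1 ∧ e j ≤ k) ∨
      (e j = e (j + 1) ∧ i = e j ∧ P i j = Tile.cross) ∨ P i j = Tile.bump := by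
  rcases Nat.lt_or_ge i (e (j + 1)) with hi | hi
  · exact Or.inl hi
  rcases Nat.lt_or_ge (e j) i with hi' | hi'
  · exact Or.inr (Or.inl ⟨i - 1, by omega, by omega⟩)
  by_cases he : e j = e (j + 1)
  · obtain rfl : i = e j := by omega
    exact Or.inr (Or.inr (Or.inl ⟨he, rfl, (h.cross hj he).1⟩))
  · obtain ⟨h1, -, h2, h3⟩ := h.bumps hj he
    refine Or.inr (Or.inr (Or.inr ?_))
    rcases (show i = e j ∨ i = e (j + 1) by omega) with rfl | rfl
    · exact h3
    · exact h2

theorem locallyValid_of_insertion (h : IsInsertion Q P c e) (hP : LocallyValid P) :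
    LocallyValid Q := by
  intro i j x y hx hy
  have key : ∀ {i' j'}, Enters P (skip c x) Side.top i' j' → Enters P (skip c y) Side.right i' j' →
      P i' j' = Q i j → (Q i j = Tile.cross → x < y) ∧ (Q i j = Tile.marked → y < x) := by
    intro i' j' hx hy hPQ
    rw [← hPQ, ← skip_lt_skip (c := c) (x := x), ← skip_lt_skip (c := c) (x := y)]
    exact hP _ _ _ _ hx hy
  rcases Nat.lt_or_ge j c with hj | hj
  · have hle := h.le hj
    have hx' : Enters P _ _ (skip (e j) i) j := (h.enters_aux hx).2 hj
    have hy' : Enters P _ _ (skip (e (j + 1)) i) j := (h.enters_aux hy).2 hj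
    rcases Nat.lt_or_ge i (e (j + 1)) with hi | hi
    · rw [skip_of_lt (by omega : i < _)] at hx' hy'
      exact key hx' hy' (h.above _ _ hj (by omega))
    · rcases Nat.lt_or_ge i (e j) with hi' | hi'
      · simp [h.bump_between hj hi hi']
      · rw [skip_of_le (by omega : _ ≤ i)] at hx' hy'
        exact key hx' hy' (h.below _ _ hj hi)
  · exact key ((h.enters_aux hx).1 hj) ((h.enters_aux hy).1 hj) (h.right _ _ hj)

/-- Only the new crossings need attention. In column `c` every pipe from the right starts further
right; to the left of it the new pipe comes from the right, and `hc` is the required comparison. -/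
theorem locallyValid (h : IsInsertion Q P c e) (hpad : Padded m Q) (hQ : LocallyValid Q)
    (hc : ∀ j < c, ∀ x, e j = e (j + 1) → Enters P x Side.top (e j) j → x < c) :
    LocallyValid P := by
  intro i j x y hx hy
  have key : ∀ {i' j' x' y'}, Enters Q x' Side.top i' j' → Enters Q y' Side.right i' j' →
      P i j = Q i' j' → x = skip c x' → y = skip c y' →
      (P i j = Tile.cross → x < y) ∧ (P i j = Tile.marked → y < x) := by
    rintro i' j' x' y' hx' hy' hPQ rfl rfl
    rw [hPQ, skip_lt_skip, skip_lt_skip]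
    exact hQ _ _ _ _ hx' hy'
  rcases Nat.lt_trichotomy j c with hj | rfl | hj
  · have hle := h.le hj
    rcases h.tile_cases hj i with hi | ⟨k, rfl, hi⟩ | ⟨he, rfl, hi⟩ | hi
    · obtain ⟨x', hx'⟩ := hpad.exists_enters Side.top i j
      obtain ⟨y', hy'⟩ := hpad.exists_enters Side.right i j
      exact key hx' hy' (h.above _ _ hj (by omega))
        (hx.label_unique ((h.enters_above_iff hpad hj hi).2 hx'))
        (hy.label_unique ((h.enters_above_iff hpad hj hi).2 hy'))
    · obtain ⟨x', hx'⟩ := hpad.exists_enters Side.top k j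
      obtain ⟨y', hy'⟩ := hpad.exists_enters Side.right k j
      exact key hx' hy' (h.below _ _ hj (by omega))
        (hx.label_unique ((h.enters_below_iff hpad hj hi).2 hx'))
        (hy.label_unique ((h.enters_below_iff hpad hj hi).2 hy'))
    · have := h.enters_right hj
      rw [← he] at this
      rw [hy.label_unique this, hi]
      simp [hc j hj x he hx]
    · simp [hi]
  · rcases Nat.lt_or_ge i (e j) with hi | hi
    · rw [hx.label_unique (h.enters_entry hi.le), h.entry_cross i hi]
      simp [hy.col_le.2 rfl]
    · simp [h.entry_bump i hi]
  · obtain ⟨j, rfl⟩ : ∃ k, j = k + 1 := ⟨j - 1, by omega⟩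
    obtain ⟨x', hx'⟩ := hpad.exists_enters Side.top i j
    obtain ⟨y', hy'⟩ := hpad.exists_enters Side.right i j
    exact key hx' hy' (h.right _ _ (by omega))
      (hx.label_unique ((h.enters_aux hx').1 (by omega)))
      (hy.label_unique ((h.enters_aux hy').1 (by omega)))

theorem traverses_succ_iff (h : IsInsertion Q P c e) (hQ : Padded m Q) (hj : c ≤ j) :
    Traverses P (skip c d) i (j + 1) ↔ Traverses Q d i j :=
  or_congr (h.enters_succ_iff hQ hj) (h.enters_succ_iff hQ hj)

theorem traverses_above_iff (h : IsInsertion Q P c e) (hQ : Padded m Q) (hj : j < c)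
    (hi : i < e (j + 1)) : Traverses P (skip c d) i j ↔ Traverses Q d i j :=
  or_congr (h.enters_above_iff hQ hj hi) (h.enters_above_iff hQ hj hi)

theorem traverses_below_iff (h : IsInsertion Q P c e) (hQ : Padded m Q) (hj : j < c)
    (hi : e j ≤ i) : Traverses P (skip c d) (i + 1) j ↔ Traverses Q d i j :=
  or_congr (h.enters_below_iff hQ hj hi) (h.enters_below_iff hQ hj hi)

/-- Every tile of `Q` that is not a merged bumping tile occurs in `P`. -/
theorem exists_tile (h : IsInsertion Q P c e) (hQ : Padded m Q) (i j : ℕ) :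
    Q i j = Tile.bump ∨ ∃ i', P i' (skip c j) = Q i j ∧
      ∀ d, Traverses P (skip c d) i' (skip c j) ↔ Traverses Q d i j := by
  rcases Nat.lt_or_ge j c with hj | hj
  · have hle := h.le hj
    rw [skip_of_lt hj]
    rcases Nat.lt_or_ge i (e (j + 1)) with hi | hi
    · exact Or.inr ⟨i, h.above _ _ hj (by omega), fun d => h.traverses_above_iff hQ hj hi⟩
    · rcases Nat.lt_or_ge i (e j) with hi' | hi'
      · exact Or.inl (h.bump_between hj hi hi')
      · exact Or.inr ⟨i + 1, h.below _ _ hj hi, fun d => h.traverses_below_iff hQ hj hi'⟩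
  · rw [skip_of_le hj]
    exact Or.inr ⟨i, h.right _ _ hj, fun d => h.traverses_succ_iff hQ hj⟩

theorem removableCol_of_insertion (h : IsInsertion Q P c e) (hQ : Padded m Q)
    (hd : RemovableCol P (skip c d)) : RemovableCol Q d where
  entry_cross := by
    intro i hx
    rcases h.exists_tile hQ i d with hb | ⟨i', h1, h2⟩
    · simp [hb] at hx
    · exact (h2 d).1 (hd.entry_cross i' (by rw [h1, hx]))
  entry_unmarked := by
    intro i hx
    rcases h.exists_tile hQ i d with hb | ⟨i', h1, h2⟩
    · simp [hb] at hx
    · exact hd.entry_unmarked i' (by rw [h1, hx])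
  above_cross := by
    intro i j hx ht hb
    rcases Nat.lt_or_ge j c with hj | hj
    · have hle := h.le hj
      rcases Nat.lt_or_ge (i + 1) (e (j + 1)) with hi | hi
      · refine hd.above_cross i j ?_ ((h.traverses_above_iff hQ hj hi).2 ht) ?_
        · rw [h.above _ _ hj (by omega), hx]
        · rw [h.above _ _ hj (by omega), hb]
      · rcases Nat.lt_or_ge (i + 1) (e j) with hi' | hi'
        · rw [h.bump_between hj hi hi'] at hx
          cases hx
        · rcases Nat.lt_or_ge i (e (j + 1)) with hi'' | hi''
          -- The new pipe crosses between the two tiles, so by greediness the upper one is not an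
          -- unmarked bump.
          · exact (h.cross hj (by omega)).2 i (by omega) hb
          · refine hd.above_cross (i + 1) j ?_ ((h.traverses_below_iff hQ hj hi').2 ht) ?_
            · rw [h.below _ _ hj (by omega), hx]
            · rw [h.below _ _ hj hi'', hb]
    · refine hd.above_cross i (j + 1) ?_ ((h.traverses_succ_iff hQ hj).2 ht) ?_
      · rw [h.right _ _ hj, hx]
      · rw [h.right _ _ hj, hb]
  unmarked := by
    intro i j ht hx
    rcases h.exists_tile hQ i j with hb | ⟨i', h1, h2⟩
    · simp [hb] at hx
    · exact hd.unmarked i' _ ((h2 d).2 ht) (by rw [h1, hx])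

theorem removableCol_skip (h : IsInsertion Q P c e) (hQ : Padded m Q)
    (hd : RemovableCol Q d) : RemovableCol P (skip c d) where
  entry_cross := by
    intro i hx
    rcases Nat.lt_or_ge d c with hdc | hdc
    · have hle := h.le hdc
      have hsk := skip_of_lt hdc
      rw [hsk] at hx ⊢
      rcases h.tile_cases hdc i with hi | ⟨k, rfl, hi⟩ | ⟨he, rfl, hi⟩ | hi
      · rw [h.above _ _ hdc (by omega)] at hx
        have := (h.traverses_above_iff hQ hdc hi).2 (hd.entry_cross i hx)
        rwa [hsk] at this
      · rw [h.below _ _ hdc (by omega)] at hx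
        have := (h.traverses_below_iff hQ hdc hi).2 (hd.entry_cross k hx)
        rwa [hsk] at this
      -- A new crossing in the entry column of `d`: the tile above it is neither an unmarked bump
      -- nor marked, hence a crossing of `d`, and `d` goes straight down into the new one.
      · rcases Nat.eq_zero_or_pos (e d) with h0 | h0
        · rw [h0]
          exact Or.inl .start
        · obtain ⟨k, hk⟩ : ∃ k, e d = k + 1 := ⟨e d - 1, by omega⟩
          have hkx : Q k d = Tile.cross := by
            by_contra hcon
            exact (h.cross hdc he).2 k hk (Tile.eq_bump hcon (hd.entry_unmarked k))
          have := (h.enters_above_iff hQ hdc (by omega)).2 (hd.entry_cross k hkx).enters_top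
          rw [hsk] at this
          rw [hk]
          exact Or.inl (this.cross_down (by rw [h.above _ _ hdc (by omega), hkx]))
      · rw [hi] at hx
        cases hx
    · rw [skip_of_le hdc] at hx ⊢
      rw [h.right _ _ hdc] at hx
      have := (h.traverses_succ_iff hQ hdc).2 (hd.entry_cross i hx)
      rwa [skip_of_le hdc] at this
  entry_unmarked := by
    intro i hx
    rcases Nat.lt_or_ge d c with hdc | hdc
    · have hle := h.le hdc
      rw [skip_of_lt hdc] at hx
      rcases h.tile_cases hdc i with hi | ⟨k, rfl, hi⟩ | ⟨he, rfl, hi⟩ | hi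
      · rw [h.above _ _ hdc (by omega)] at hx
        exact hd.entry_unmarked _ hx
      · rw [h.below _ _ hdc (by omega)] at hx
        exact hd.entry_unmarked _ hx
      · simp [hi] at hx
      · simp [hi] at hx
    · rw [skip_of_le hdc, h.right _ _ hdc] at hx
      exact hd.entry_unmarked _ hx
  above_cross := by
    intro i j hx ht hb
    rcases Nat.lt_trichotomy j c with hj | rfl | hj
    · have hle := h.le hj
      rcases h.tile_cases hj (i + 1) with hi | ⟨k, hk, hi⟩ | ⟨he, hi, -⟩ | hi
      · rw [h.above _ _ hj (by omega)] at hx hb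
        exact hd.above_cross i j hx ((h.traverses_above_iff hQ hj hi).1 ht) hb
      · obtain rfl : k = i := by omega
        rw [h.below _ _ hj (by omega)] at hx
        have ht := (h.traverses_below_iff hQ hj hi).1 ht
        -- In the equality case the tile above belongs to the inserted pipe. It is a crossing, or
        -- the lower half of a split bump that lies above the crossing of `d` in `Q`.
        rcases hi.eq_or_lt with hi | hi
        · by_cases he : e j = e (j + 1)
          · have := (h.cross hj he).1
            rw [hi, hb] at this
            cases this
          · obtain ⟨h1, h2, -⟩ := h.bumps hj he
            obtain ⟨l, rfl⟩ : ∃ l, k = l + 1 := ⟨k - 1, by omega⟩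
            rw [show e (j + 1) = l by omega] at h2
            exact hd.above_cross l j hx ht h2
        · obtain ⟨l, rfl⟩ : ∃ l, k = l + 1 := ⟨k - 1, by omega⟩
          rw [h.below _ _ hj (by omega)] at hb
          exact hd.above_cross l j hx ht hb
      · rw [h.above _ _ hj (by omega)] at hb
        exact (h.cross hj he).2 i hi.symm hb
      · rw [hi] at hx
        cases hx
    · rcases Nat.lt_or_ge (i + 1) (e j) with hi | hi
      · rw [h.entry_cross i (by omega)] at hb
        cases hb
      · rw [h.entry_bump _ hi] at hx
        cases hx
    · obtain ⟨j, rfl⟩ : ∃ k, j = k + 1 := ⟨j - 1, by omega⟩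
      rw [h.right _ _ (by omega)] at hx hb
      exact hd.above_cross i j hx ((h.traverses_succ_iff hQ (by omega)).1 ht) hb
  unmarked := by
    intro i j ht hx
    rcases Nat.lt_trichotomy j c with hj | rfl | hj
    · have hle := h.le hj
      rcases h.tile_cases hj i with hi | ⟨k, rfl, hi⟩ | ⟨he, rfl, hi⟩ | hi
      · rw [h.above _ _ hj (by omega)] at hx
        exact hd.unmarked _ _ ((h.traverses_above_iff hQ hj hi).1 ht) hx
      · rw [h.below _ _ hj (by omega)] at hx
        exact hd.unmarked _ _ ((h.traverses_below_iff hQ hj hi).1 ht) hx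
      · simp [hi] at hx
      · simp [hi] at hx
    · rcases Nat.lt_or_ge i (e j) with hi | hi
      · simp [h.entry_cross i hi] at hx
      · simp [h.entry_bump _ hi] at hx
    · obtain ⟨j, rfl⟩ : ∃ k, j = k + 1 := ⟨j - 1, by omega⟩
      rw [h.right _ _ (by omega)] at hx
      exact hd.unmarked _ _ ((h.traverses_succ_iff hQ (by omega)).1 ht) hx

theorem removableCol_skip_iff (h : IsInsertion Q P c e) (hQ : Padded m Q) :
    RemovableCol P (skip c d) ↔ RemovableCol Q d :=
  ⟨h.removableCol_of_insertion hQ, h.removableCol_skip hQ⟩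

/-! ### The obstruction: the pattern 1423 -/

/-- If the inserted pipe `c` crosses a pipe `d` twice, then the pipes in which the pipe dream ends
contain the pattern `1423`: there are pipes `x < c < d < f` that leave in the order
`x, f, c, d`. -/
theorem exists_exits_of_crossing (h : IsInsertion Q P c e) (hpad : Padded m Q)
    (hP : Padded (m + 1) P) (hQ : LocallyValid Q) (hj : j < c) (he : e j = e (j + 1))
    (hd : Enters P d Side.top (e j) j) (hcd : c ≤ d) :
    ∃ x f d' k₁ k₂ k₃, x < c ∧ c < d' ∧ d' < f ∧ d' < m + 1 ∧ k₁ < k₂ ∧ k₂ < e 0 ∧ e 0 < k₃ ∧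
      Exits P x k₁ ∧ Exits P f k₂ ∧ Exits P d' k₃ := by
  induction j using Nat.strong_induction_on generalizing d with
  | _ j ih =>
  -- Reduction to the leftmost wrong crossing.
  by_cases hmin : ∃ j' < j, e j' = e (j' + 1) ∧ ∃ d', Enters P d' Side.top (e j') j' ∧ c ≤ d'
  · obtain ⟨j', hj', he', d', hd', hcd'⟩ := hmin
    exact ih j' hj' (by omega) he' hd' hcd'
  have hcd : c < d := by
    refine lt_of_le_of_ne hcd ?_
    rintro rfl
    rcases h.trace hd with ⟨-, h1, -⟩ | ⟨h1, -⟩ | ⟨-, -, -, h1⟩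
    · omega
    · cases h1
    · omega
  obtain ⟨hx, hb⟩ := h.cross hj he
  obtain ⟨k, hk⟩ : ∃ k, e j = k + 1 := by
    refine Nat.exists_eq_succ_of_ne_zero fun h0 => ?_
    rw [h0] at hd
    cases hd
    omega
  have hbump := hb k hk
  have hPQ := h.above k j hj (by omega)
  have labels : ∀ x y, Enters P x Side.top k j → Enters P y Side.right k j →
      (P k j = Tile.cross → x < y) ∧ (P k j = Tile.marked → y < x) := by
    intro x y hx hy
    obtain ⟨x', hx'⟩ := hpad.exists_enters Side.top k j
    obtain ⟨y', hy'⟩ := hpad.exists_enters Side.right k j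
    rw [hx.label_unique ((h.enters_above_iff hpad hj (by omega)).2 hx'),
      hy.label_unique ((h.enters_above_iff hpad hj (by omega)).2 hy'), hPQ, skip_lt_skip,
      skip_lt_skip]
    exact hQ _ _ _ _ hx' hy'
  -- The tile above the crossing is a crossing or marked, by greediness. Pipe `d` leaves it through
  -- the bottom; the other pipe `f` leaves to the left, and local validity gives `d < f` in both
  -- cases.
  obtain ⟨f, hf, hdf, hfj⟩ : ∃ f, LeavesLeft P f k j ∧ d < f ∧ ¬ Enters P j Side.top k j := by
    obtain ⟨f, hf⟩ := hP.exists_leavesLeft k j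
    rw [hk] at hd
    cases hd with
    | cross_down h1 h2 =>
      have hf' := (hf.resolve_left fun h => h.2 h2).1
      refine ⟨f, hf, (labels _ _ h1 hf').1 h2, fun h3 => ?_⟩
      have := h1.label_unique h3
      omega
    | bump_down h1 h2 =>
      have hf' := (hf.resolve_right fun h => h2 h.2).1
      have hm : P k j = Tile.marked := by
        by_contra hcon
        exact hbump (hPQ ▸ Tile.eq_bump h2 hcon)
      have hlt := (labels _ _ hf' h1).2 hm
      refine ⟨f, hf, hlt, fun h3 => ?_⟩
      have := hf'.label_unique h3
      omega
  -- The pipe that starts in column `j < c` has already turned left above row `k`; it is the first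
  -- choice of `x`.
  obtain ⟨k₁, hk₁, hxj⟩ := (enters_or_leavesLeft P k j).resolve_left hfj
  -- Further left, `f` stays above `c`, since passing it would be a wrong crossing further left. If
  -- `x` is deflected downwards, or the pipe of column `j'` has left earlier, that pipe takes the
  -- place of `x`.
  have above : ∀ j' ≤ j, ∃ x k₁ k₂, x < c ∧ k₁ < k₂ ∧ k₂ < e j' ∧ LeavesLeft P x k₁ j' ∧
      LeavesLeft P f k₂ j' := by
    intro j' hj'
    induction hj' using Nat.decreasingInduction with
    | self => exact ⟨j, k₁, k, hj, hk₁, by omega, hxj, hf⟩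
    | of_succ j' hj' ih =>
      obtain ⟨x, k₁, k₂, hxc, h12, h2e, hx, hf⟩ := ih
      have hjc : j' < c := by omega
      have hle := h.le hjc
      rw [← enters_right_iff] at hx hf
      obtain ⟨k₂', hk₂, hke, hf'⟩ : ∃ k₂', k₂ ≤ k₂' ∧ k₂' < e j' ∧ LeavesLeft P f k₂' j' := by
        by_cases hx2 : P k₂ j' = Tile.cross
        · exact ⟨k₂, le_rfl, by omega, Or.inr ⟨hf, hx2⟩⟩
        · obtain ⟨k₂', hk₂, hf', hr⟩ := hP.exists_leavesLeft_of_enters (hf.bump_down hx2)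
          refine ⟨k₂', by omega, ?_, hf'⟩
          by_contra hcon
          have hfe := hr (e j') (by omega) (by omega)
          by_cases he' : e j' = e (j' + 1)
          · exact hmin ⟨j', hj', he', f, hfe, by omega⟩
          · obtain ⟨h1, -, h2, -⟩ := h.bumps hjc he'
            have hce := (h.enters_right hjc).bump_down (by rw [h2]; simp)
            rw [← h1] at hce
            have := hce.label_unique hfe
            omega
      rcases enters_or_leavesLeft P k₁ j' with h3 | ⟨k₃, hk₃, h3⟩
      · by_cases hx1 : P k₁ j' = Tile.cross
        · exact ⟨x, k₁, k₂', hxc, by omega, hke, Or.inr ⟨hx, hx1⟩, hf'⟩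
        · exact ⟨j', k₁, k₂', hjc, by omega, hke, Or.inl ⟨h3, hx1⟩, hf'⟩
      · exact ⟨j', k₃, k₂', hjc, by omega, hke, h3, hf'⟩
  -- After the crossing, `d` stays below `c` all the way to the left boundary.
  have below : ∀ j' ≤ j, ∃ k₃, e j' < k₃ ∧ LeavesLeft P d k₃ j' := by
    intro j' hj'
    induction hj' using Nat.decreasingInduction with
    | self =>
      obtain ⟨k₃, h3, hd', -⟩ := hP.exists_leavesLeft_of_enters (hd.cross_down hx)
      exact ⟨k₃, h3, hd'⟩
    | of_succ j' hj' ih =>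
      obtain ⟨k₃, h3, hd'⟩ := ih
      have hjc : j' < c := by omega
      have hle := h.le hjc
      rw [← enters_right_iff] at hd'
      by_cases hx3 : P k₃ j' = Tile.cross
      · refine ⟨k₃, ?_, Or.inr ⟨hd', hx3⟩⟩
        by_contra hcon
        have h4 := (h.bumps hjc (by omega)).2.2.2
        rw [show e j' = k₃ by omega, hx3] at h4
        cases h4
      · obtain ⟨k₃', hk₃, hd'', -⟩ := hP.exists_leavesLeft_of_enters (hd'.bump_down hx3)
        exact ⟨k₃', by omega, hd''⟩
  obtain ⟨x, k₁, k₂, hxc, h12, h2e, hx', hf'⟩ := above 0 (by omega)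
  obtain ⟨k₃, h3, hd'⟩ := below 0 (by omega)
  exact ⟨x, f, d, k₁, k₂, k₃, hxc, hcd, hdf, hd.lt_of_ne_bump hP (by rw [hx]; simp), h12, h2e, h3,
    hx', hf', hd'⟩

end IsInsertion

/-! ### Words, entry columns and a single deletion -/

variable {v : List ℕ} {a b : ℕ}

theorem entryCol_eq_of_perm {l : List ℕ} (h : v.Perm l) (b : ℕ) : entryCol v b = entryCol l b :=
  h.countP_eq _

theorem entryCol_cons (a : ℕ) (l : List ℕ) (b : ℕ) :
    entryCol (a :: l) b = entryCol l b + if a < b then 1 else 0 := by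
  simp [entryCol, List.countP_cons]

theorem entryCol_mono (l : List ℕ) (h : a ≤ b) : entryCol l a ≤ entryCol l b := by
  refine List.countP_mono_left fun x _ hx => ?_
  simp only [decide_eq_true_eq] at hx ⊢
  omega

theorem entryCol_lt_entryCol (ha : a ∈ v) (h : a < b) : entryCol v a < entryCol v b := by
  have := entryCol_mono (v.erase a) h.le
  rw [entryCol_eq_of_perm (List.perm_cons_erase ha), entryCol_eq_of_perm (List.perm_cons_erase ha),
    entryCol_cons, entryCol_cons, if_neg (lt_irrefl a), if_pos h]
  omega

theorem entryCol_lt_iff (ha : a ∈ v) : entryCol v a < entryCol v b ↔ a < b := by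
  refine ⟨fun h => ?_, entryCol_lt_entryCol ha⟩
  by_contra hcon
  have := entryCol_mono v (not_lt.1 hcon)
  omega

theorem entryCol_inj (ha : a ∈ v) (hb : b ∈ v) : entryCol v a = entryCol v b ↔ a = b := by
  have h1 := entryCol_lt_iff (b := b) ha
  have h2 := entryCol_lt_iff (b := a) hb
  omega

theorem entryCol_lt_length (ha : a ∈ v) : entryCol v a < v.length := by
  rw [entryCol_eq_of_perm (List.perm_cons_erase ha), entryCol_cons, if_neg (lt_irrefl a),
    (List.perm_cons_erase ha).length_eq, List.length_cons]
  exact Nat.lt_succ_of_le List.countP_le_length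

theorem entryCol_erase (ha : a ∈ v) (hb : b ∈ v) (hne : b ≠ a) :
    entryCol v b = skip (entryCol v a) (entryCol (v.erase a) b) := by
  have hb' : b ∈ v.erase a := (List.mem_erase_of_ne hne).2 hb
  rw [entryCol_eq_of_perm (List.perm_cons_erase ha), entryCol_eq_of_perm (List.perm_cons_erase ha),
    entryCol_cons, entryCol_cons, if_neg (lt_irrefl a)]
  rcases Nat.lt_or_gt_of_ne hne with h | h
  · rw [skip_of_lt (by simpa using entryCol_lt_entryCol hb' h), if_neg (by omega)]
    simp
  · rw [skip_of_le (by simpa using entryCol_mono _ h.le), if_pos h]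

theorem getElem_erase {i : ℕ} (hi : i < (v.erase a).length)
    (hi' : skip (v.idxOf a) i < v.length) : (v.erase a)[i] = v[skip (v.idxOf a) i] := by
  simp only [List.erase_eq_eraseIdx_of_idxOf (i := v.idxOf a) rfl, List.getElem_eraseIdx]
  unfold skip
  split_ifs <;> rfl

theorem length_eq_succ (ha : a ∈ v) : v.length = (v.erase a).length + 1 := by
  rw [(List.perm_cons_erase ha).length_eq, List.length_cons]

/-- The exit row of the pipe is the position of `a` in the word, so `IsInsertion.unique` can later
be applied with a row known from `v` alone. -/
theorem IsMRPD.delete (hv : v.Nodup) (ha : a ∈ v) (h : IsMRPD v P)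
    (hI : IsInsertion Q P (entryCol v a) e) : e 0 = v.idxOf a ∧ IsMRPD (v.erase a) Q := by
  have hlen := length_eq_succ ha
  have hP : Padded v.length P := h.staircase
  have hc := entryCol_lt_length ha
  have hexit : Exits P (entryCol v a) (e 0) := hI.leavesLeft (Nat.zero_le _)
  have he0 : e 0 < v.length := by
    rcases hexit with ⟨h1, -⟩ | ⟨h1, -⟩ <;> exact (h1.add_lt hP hc).1
  have hidx : e 0 = v.idxOf a := by
    have h1 := (entryCol_inj (List.getElem_mem he0) ha).1
      (LeavesLeft.label_unique (h.word _ he0) hexit)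
    rw [← hv.idxOf_getElem _ he0, h1]
  have hQ : Padded (v.erase a).length Q := hI.padded (hlen ▸ hP) (by omega)
  refine ⟨hidx, (hI.locallyValid_of_insertion h.locallyValid).isMRPD hQ fun i hi => ?_⟩
  have hi' : skip (v.idxOf a) i < v.length := by unfold skip; split_ifs <;> omega
  rw [← hI.exits_iff hQ, getElem_erase hi hi', ← entryCol_erase ha (List.getElem_mem hi'), hidx]
  · exact h.word _ hi'
  · rw [← getElem_erase hi hi']
    exact fun heq => (hv.mem_erase_iff.1 (heq ▸ List.getElem_mem hi)).1 rfl

/-- The word `v` avoids the pattern `1423`. -/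
def WordAvoids1423 (v : List ℕ) : Prop :=
  ∀ (k₁ k₂ k₃ k₄ : ℕ) (h₁₂ : k₁ < k₂) (h₂₃ : k₂ < k₃) (h₃₄ : k₃ < k₄) (h₄ : k₄ < v.length),
    ¬ (v[k₁] < v[k₃] ∧ v[k₃] < v[k₄] ∧ v[k₄] < v[k₂])

theorem Avoids1423.wordAvoids1423 {n : ℕ} {w : Equiv.Perm (Fin n)} (hw : Avoids1423 w)
    (hv : v.Sublist (oneLine w)) : WordAvoids1423 v := by
  rintro k₁ k₂ k₃ k₄ h₁₂ h₂₃ h₃₄ h₄ ⟨h1, h2, h3⟩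
  obtain ⟨f, hf⟩ := List.sublist_iff_exists_fin_orderEmbedding_get_eq.1 hv
  have hlen : (oneLine w).length = n := List.length_ofFn
  have key : ∀ k (hk : k < v.length), v[k] = (w (Fin.cast hlen (f ⟨k, hk⟩)) : ℕ) + 1 := by
    intro k hk
    have := hf ⟨k, hk⟩
    simp only [oneLine, List.get_eq_getElem, List.getElem_ofFn] at this
    exact this
  have mono : ∀ k k' (hk : k < v.length) (hk' : k' < v.length), k < k' →
      Fin.cast hlen (f ⟨k, hk⟩) < Fin.cast hlen (f ⟨k', hk'⟩) := by
    intro k k' hk hk' h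
    have : f ⟨k, hk⟩ < f ⟨k', hk'⟩ := f.lt_iff_lt.2 h
    exact this
  simp only [key] at h1 h2 h3
  refine hw ⟨_, _, _, _, mono k₁ k₂ (by omega) (by omega) h₁₂,
    mono k₂ k₃ (by omega) (by omega) h₂₃, mono k₃ k₄ (by omega) h₄ h₃₄, ?_, ?_, ?_⟩ <;>
  · rw [Fin.lt_def]
    omega

/-- The greedy insertion in the row prescribed by the position of `a`; a wrong crossing would
exhibit the forbidden pattern in `v`. -/
theorem IsMRPD.exists_insert (hv : v.Nodup) (hpat : WordAvoids1423 v) (ha : a ∈ v)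
    (hQ : IsMRPD (v.erase a) Q) :
    ∃ P, IsMRPD v P ∧ ∃ e, IsInsertion Q P (entryCol v a) e := by
  have hlen := length_eq_succ ha
  have hc := entryCol_lt_length ha
  have hp := List.idxOf_lt_length_of_mem ha
  have hpad : Padded (v.erase a).length Q := hQ.staircase
  obtain ⟨P, e, hI, he0, hP⟩ := exists_isInsertion hpad (p := v.idxOf a) (c := entryCol v a)
    (by omega) (by omega)
  rw [← hlen] at hP
  have hword : ∀ (i : ℕ) (hi : i < v.length), Exits P (entryCol v v[i]) i := by
    intro i hi
    by_cases hip : i = v.idxOf a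
    · subst hip
      rw [List.getElem_idxOf, ← he0]
      exact hI.leavesLeft (Nat.zero_le _)
    · obtain ⟨k, rfl⟩ := exists_skip_of_ne hip
      have hk : k < (v.erase a).length := by
        unfold skip at hi
        split_ifs at hi <;> omega
      rw [entryCol_erase ha (List.getElem_mem hi), ← getElem_erase hk hi, ← he0]
      · exact hI.exits (hQ.word k hk)
      · rw [← getElem_erase hk hi]
        exact fun heq => (hv.mem_erase_iff.1 (heq ▸ List.getElem_mem hk)).1 rfl
  refine ⟨P, LocallyValid.isMRPD ?_ hP hword, e, hI⟩
  refine hI.locallyValid hpad hQ.locallyValid fun j hj x he hx => ?_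
  by_contra hcon
  obtain ⟨x, f, d, k₁, k₂, k₃, hxc, hcd, hdf, hd, h12, h2, h3, hx, hf, hd'⟩ :=
    hI.exists_exits_of_crossing hpad (hlen ▸ hP) hQ.locallyValid hj he hx (not_lt.1 hcon)
  have hk₃ : k₃ < v.length := by
    rcases hd' with ⟨h1, -⟩ | ⟨h1, -⟩ <;> exact (h1.add_lt hP (by omega)).1
  rw [he0] at h2 h3
  have hcd' : entryCol v v[v.idxOf a] = entryCol v a := by rw [List.getElem_idxOf]
  refine hpat k₁ k₂ (v.idxOf a) k₃ h12 h2 h3 hk₃ ⟨?_, ?_, ?_⟩ <;>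
    rw [← entryCol_lt_iff (List.getElem_mem _)]
  · rwa [hcd', LeavesLeft.label_unique (hword k₁ (by omega)) hx]
  · rwa [hcd', LeavesLeft.label_unique (hword k₃ (by omega)) hd']
  · rwa [LeavesLeft.label_unique (hword k₃ (by omega)) hd',
      LeavesLeft.label_unique (hword k₂ (by omega)) hf]

/-! ### Deletion of several pipes -/

theorem Removable.exists_isInsertion (h : IsMRPD v P) (ha : Removable v P a) :
    ∃ e, IsInsertion (deleteCol P (entryCol v a)) P (entryCol v a) e :=
  ha.2.exists_isInsertion (m := v.length) h.staircase

theorem IsInsertion.removable_iff (hI : IsInsertion Q P (entryCol v a) e) (ha : a ∈ v)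
    (hQ : Padded m Q) (hne : b ≠ a) : Removable v P b ↔ Removable (v.erase a) Q b := by
  unfold Removable
  rw [List.mem_erase_of_ne hne]
  refine and_congr_right fun hb => ?_
  rw [entryCol_erase ha hb hne]
  exact hI.removableCol_skip_iff hQ

/-- Removability of the remaining labels survives each deletion, and none becomes removable; the
last clause therefore yields a core result. -/
theorem foldl_deletePipe {l : List ℕ} (hl : l.Nodup) (hv : v.Nodup) (hP : IsMRPD v P)
    (hr : ∀ a ∈ l, Removable v P a) :
    ∃ Q, l.foldl deletePipe (v, P) = (v.diff l, Q) ∧ IsMRPD (v.diff l) Q ∧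
      ∀ b ∉ l, Removable (v.diff l) Q b → Removable v P b := by
  induction l generalizing v P with
  | nil => exact ⟨P, by simp, by simpa using hP, by simp⟩
  | cons a l ih =>
    have ha := hr a (by simp)
    obtain ⟨e, hI⟩ := ha.exists_isInsertion hP
    obtain ⟨-, hQ⟩ := hP.delete hv ha.1 hI
    have iff : ∀ {b}, b ≠ a → (Removable v P b ↔ _) := fun hne =>
      hI.removable_iff ha.1 hQ.staircase hne
    have hal : a ∉ l := (List.nodup_cons.1 hl).1
    obtain ⟨R, h1, h2, h3⟩ := ih (List.nodup_cons.1 hl).2 (hv.erase a) hQ fun b hb =>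
      (iff fun h => hal (h ▸ hb)).1 (hr b (List.mem_cons_of_mem _ hb))
    rw [List.diff_cons]
    refine ⟨R, h1, h2, fun b hb hrem => ?_⟩
    rw [List.mem_cons, not_or] at hb
    exact (iff hb.1).2 (h3 b hb.2 hrem)

theorem foldl_deletePipe_injective {P' : Filling} {l : List ℕ} (hl : l.Nodup) (hv : v.Nodup)
    (hP : IsMRPD v P) (hr : ∀ a ∈ l, Removable v P a) (hP' : IsMRPD v P')
    (hr' : ∀ a ∈ l, Removable v P' a)
    (h : l.foldl deletePipe (v, P) = l.foldl deletePipe (v, P')) : P = P' := by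
  induction l generalizing v P P' with
  | nil => simpa using h
  | cons a l ih =>
    have ha := hr a (by simp)
    have hal : a ∉ l := (List.nodup_cons.1 hl).1
    obtain ⟨e, hI⟩ := ha.exists_isInsertion hP
    obtain ⟨e', hI'⟩ := (hr' a (by simp)).exists_isInsertion hP'
    obtain ⟨h0, hQ⟩ := hP.delete hv ha.1 hI
    obtain ⟨h0', hQ'⟩ := hP'.delete hv ha.1 hI'
    have heq := ih (List.nodup_cons.1 hl).2 (hv.erase a) hQ
      (fun b hb => (hI.removable_iff ha.1 hQ.staircase fun h => hal (h ▸ hb)).1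
        (hr b (List.mem_cons_of_mem _ hb))) hQ'
      (fun b hb => (hI'.removable_iff ha.1 hQ'.staircase fun h => hal (h ▸ hb)).1
        (hr' b (List.mem_cons_of_mem _ hb))) h
    rw [← heq] at hI'
    exact hI.unique hI' (h0.trans h0'.symm)

/-- The labels are inserted from the end of the list to its head. All intermediate words are
subwords of `w`, so they avoid the pattern too. -/
theorem exists_foldl_deletePipe {l : List ℕ} {n : ℕ} {w : Equiv.Perm (Fin n)} (hw : Avoids1423 w)
    (hl : l.Nodup) (hv : v.Nodup) (hvw : v.Sublist (oneLine w)) (hlv : l ⊆ v)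
    (hQ : IsMRPD (v.diff l) Q) :
    ∃ P, IsMRPD v P ∧ l.foldl deletePipe (v, P) = (v.diff l, Q) ∧ (∀ a ∈ l, Removable v P a) ∧
      ∀ b ∉ l, Removable v P b → Removable (v.diff l) Q b := by
  induction l generalizing v with
  | nil => exact ⟨Q, by simpa using hQ, by simp, by simp, by simp⟩
  | cons a l ih =>
    obtain ⟨hal, hl'⟩ := List.nodup_cons.1 hl
    have ha : a ∈ v := hlv (by simp)
    rw [List.diff_cons] at hQ ⊢
    have hne : ∀ b ∈ l, b ≠ a := fun b hb h => hal (h ▸ hb)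
    obtain ⟨R, hR, h1, h2, h3⟩ := ih hl' (hv.erase a) (List.erase_sublist.trans hvw)
      (fun b hb => (List.mem_erase_of_ne (hne b hb)).2 (hlv (List.mem_cons_of_mem _ hb))) hQ
    obtain ⟨P, hP, e, hI⟩ := IsMRPD.exists_insert hv (hw.wordAvoids1423 hvw) ha hR
    have iff : ∀ {b}, b ≠ a → (Removable v P b ↔ _) := fun hne =>
      hI.removable_iff ha hR.staircase hne
    refine ⟨P, hP, ?_, ?_, ?_⟩
    · rw [List.foldl_cons, ← h1, deletePipe, hI.deleteCol_eq]
    · intro b hb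
      rcases List.mem_cons.1 hb with rfl | hb
      · exact ⟨ha, hI.removableCol⟩
      · exact (iff (hne b hb)).2 (h2 b hb)
    · intro b hb hrem
      rw [List.mem_cons, not_or] at hb
      exact h3 b hb.2 ((iff hb.1).1 hrem)

theorem nodup_oneLine {n : ℕ} (w : Equiv.Perm (Fin n)) : (oneLine w).Nodup :=
  List.nodup_ofFn.2 fun i j h => w.injective (Fin.ext (by simpa using h))

theorem diff_filter_notMem {l o : List ℕ} (hl : l.Nodup) (h : v.Sublist l) (ho : o.Perm l) :
    l.diff (o.filter (fun a => decide (a ∉ v))) = v := by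
  have hsub : v.Sublist (l.diff (o.filter (fun a => decide (a ∉ v)))) := by
    rw [hl.sdiff_eq_filter]
    have := h.filter (fun x => decide (x ∉ o.filter (fun a => decide (a ∉ v))))
    rwa [List.filter_eq_self.2 fun a ha => by simp [ha]] at this
  refine (hsub.eq_of_length_le ?_).symm
  refine (List.Nodup.subperm (hl.sublist (List.diff_sublist _ _)) fun x hx => ?_).length_le
  rw [hl.mem_sdiff_iff] at hx
  by_contra hcon
  exact hx.2 (List.mem_filter.2 ⟨ho.mem_iff.2 hx.1, by simpa using hcon⟩)

end PipeDream

theorem theorem3p6 (n : ℕ) (w : Equiv.Perm (Fin n)) (hw : PipeDream.Avoids1423 w)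
    (order : List ℕ) (horder : order.Perm (PipeDream.oneLine w)) :
    Set.BijOn (fun P => PipeDream.reduction order (PipeDream.oneLine w) P)
      (PipeDream.MRPD (PipeDream.oneLine w)) (PipeDream.coresOfSubwords w) := by
  classical
  open PipeDream in
  have hnd := nodup_oneLine w
  have hord : order.Nodup := horder.nodup_iff.2 hnd
  have hmem : ∀ {P a}, a ∈ order.filter (fun a => decide (Removable (oneLine w) P a)) ↔
      Removable (oneLine w) P a := by
    intro P a
    simp only [List.mem_filter, decide_eq_true_eq, and_iff_right_iff_imp]
    exact fun h => horder.mem_iff.2 h.1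
  have hred : ∀ P, reduction order (oneLine w) P =
      (order.filter (fun a => decide (Removable (oneLine w) P a))).foldl deletePipe
        (oneLine w, P) := by
    intro P
    unfold reduction
    congr
  refine ⟨fun P hP => ?_, fun P hP P' hP' h => ?_, fun ⟨v, Q⟩ ⟨hv, hQ, hcore⟩ => ?_⟩
  · obtain ⟨Q, h1, h2, h3⟩ := foldl_deletePipe (hord.filter _) hnd hP fun a => hmem.1
    simp only [hred, h1]
    refine ⟨List.diff_sublist _ _, h2, fun b hb => ?_⟩
    by_cases hbl : b ∈ order.filter (fun a => decide (Removable (oneLine w) P a))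
    · exact ((hnd.mem_sdiff_iff).1 hb.1).2 hbl
    · exact hbl (hmem.2 (h3 b hbl hb))
  · obtain ⟨Q, h1, -⟩ := foldl_deletePipe (hord.filter _) hnd hP fun a => hmem.1
    obtain ⟨Q', h1', -⟩ := foldl_deletePipe (hord.filter _) hnd hP' fun a => hmem.1
    simp only [hred] at h
    -- The entries are distinct, so the remaining word determines the set of deleted labels.
    have hdiff := congrArg Prod.fst ((h1.symm.trans h).trans h1')
    have hrem : ∀ a, Removable (oneLine w) P a ↔ Removable (oneLine w) P' a := by
      intro a
      by_cases ha : a ∈ oneLine w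
      · have h2 := congrArg (a ∈ ·) hdiff
        simp only [hnd.mem_sdiff_iff, hmem, ha, true_and, eq_iff_iff] at h2
        exact not_iff_not.1 h2
      · exact ⟨fun h => absurd h.1 ha, fun h => absurd h.1 ha⟩
    have hlist : order.filter (fun a => decide (Removable (oneLine w) P' a)) =
        order.filter (fun a => decide (Removable (oneLine w) P a)) := by
      simp only [hrem]
    rw [hlist] at h
    exact foldl_deletePipe_injective (hord.filter _) hnd hP (fun a => hmem.1) hP'
      (fun a ha => (hrem a).1 (hmem.1 ha)) h
  · have hdiff := diff_filter_notMem hnd hv horder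
    obtain ⟨P, hP, h1, h2, h3⟩ := exists_foldl_deletePipe (Q := Q) hw
      (hord.filter (fun a => decide (a ∉ v))) hnd (List.Sublist.refl _)
      (fun a ha => horder.mem_iff.1 (List.mem_of_mem_filter ha)) (by rwa [hdiff])
    refine ⟨P, hP, ?_⟩
    -- Since `Q` is core, no label of `v` is removable in `P`; the inserted labels all are.
    have hlist : order.filter (fun a => decide (Removable (oneLine w) P a)) =
        order.filter (fun a => decide (a ∉ v)) := by
      refine List.filter_congr fun a ha => decide_eq_decide.2 ⟨fun hr hav => ?_, fun hav => ?_⟩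
      · refine hcore a (hdiff ▸ h3 a (fun hmem => ?_) hr)
        simp [hav] at hmem
      · exact h2 a (List.mem_filter.2 ⟨ha, by simpa using hav⟩)
    simp only [hred, hlist, h1, hdiff]
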